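/- Represent lambda-terms modulo $\alpha$-equivalence by De Bruijn terms: a term is a variable (written as a positive integer, its De Bruijn index, which counts the abstractions between the variable and its binding $\lambda$, including the binding one), an application of two terms, or an abstraction of a term. A term is closed if every variable is bound by an abstraction of the term. The size $|t|$ of a term $t$ is its number of nodes (variables, applications and abstractions, each counted once), and $\mathrm{lv}(t)$ denotes its number of leaves, i.e. of occurrences of variables. Fix $k\in\mathbb N$, let $\mathcal G_k$ be the class of closed lambda-terms all of whose De Bruijn indices are at most $k$, and let $$G_k(z,u)=\sum_{t\in\mathcal G_k} z^{|t|}u^{\mathrm{lv}(t)}$$ be its bivariate generating function. For complex $u$ let $c_1(u)=1$ and $c_j(u)=4(j-1)u-1+2\sqrt{c_{j-1}(u)}$ for $2\le j\le k+1$, where all square roots are principal branches. Then there is $\delta>0$ (depending only on $k$) such that $$[z^n]G_k(z,u)=\sqrt{\frac{\sqrt{ku}+2ku}{4\pi\prod_{l=2}^{k+1}c_l(u)}}\;\bigl(1+2\sqrt{ku}\bigr)^n\,n^{-3/2}\left(1+O\!\left(\frac1{\sqrt n}\right)\right)\qquad(n\to\infty),$$ uniformly in complex $u$ with $|u-1|<\delta$;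 that is, the constant implied by $O$ and the threshold for $n$ depend only on $k$. -/

import Mathlib

open scoped Polynomial

/-- Lambda-terms modulo alpha-equivalence, in De Bruijn representation. A variable is replaced by
its De Bruijn index, a positive integer: the number of abstractions between the variable and its
binding lambda, the binding lambda included. -/
inductive LambdaTerm : Type
  | var (i : ℕ+) : LambdaTerm
  | app (s t : LambdaTerm) : LambdaTerm
  | abs (t : LambdaTerm) : LambdaTerm

namespace LambdaTerm

/-- The size of a term: the number of nodes (variables, applications, abstractions). -/
def size : LambdaTerm → ℕ
  | var _ => 1
  | app s t => s.size + t.size + 1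
  | abs t => t.size + 1

/-- The number of leaves, i.e. of occurrences of variables. -/
def leaves : LambdaTerm → ℕ
  | var _ => 1
  | app s t => s.leaves + t.leaves
  | abs t => t.leaves

/-- Every variable is bound, if the term stands in the scope of `d` further abstractions. -/
def ClosedUnder : LambdaTerm → ℕ → Prop
  | var i, d => (i : ℕ) ≤ d
  | app s t, d => s.ClosedUnder d ∧ t.ClosedUnder d
  | abs t, d => t.ClosedUnder (d + 1)

/-- A term is closed if every variable is bound by an abstraction of the term. -/
def IsClosed (t : LambdaTerm) : Prop := t.ClosedUnder 0

/-- All De Bruijn indices are at most `k`. -/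
def IndicesLE (k : ℕ) : LambdaTerm → Prop
  | var i => (i : ℕ) ≤ k
  | app s t => s.IndicesLE k ∧ t.IndicesLE k
  | abs t => t.IndicesLE k

/-- The closed lambda-terms of size `n` all of whose De Bruijn indices are at most `k`. -/
def closedTerms (k n : ℕ) : Set LambdaTerm :=
  {t | t.IsClosed ∧ t.IndicesLE k ∧ t.size = n}

theorem finite_indicesLE (k n : ℕ) :
    {t : LambdaTerm | t.IndicesLE k ∧ t.size ≤ n}.Finite := by
  induction n with
  | zero =>
    refine Set.finite_empty.subset ?_
    rintro t ⟨-, h⟩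
    cases t <;> simp [size] at h
  | succ n ih =>
    have hv : {i : ℕ+ | (i : ℕ) ≤ k}.Finite :=
      (Set.finite_Iic k).preimage (PNat.coe_injective.injOn)
    refine (((hv.image var).union (ih.image abs)).union (Set.Finite.image2 app ih ih)).subset ?_
    rintro t ⟨h1, h2⟩
    cases t with
    | var i => exact Or.inl (Or.inl ⟨i, h1, rfl⟩)
    | abs t =>
      simp only [size] at h2
      exact Or.inl (Or.inr ⟨t, ⟨h1, by omega⟩, rfl⟩)
    | app s t =>
      simp only [size] at h2
      exact Or.inr ⟨s, ⟨h1.1, by omega⟩, t, ⟨h1.2, by omega⟩, rfl⟩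

theorem finite_closedTerms (k n : ℕ) : (closedTerms k n).Finite :=
  (finite_indicesLE k n).subset fun _ h => ⟨h.2.1, h.2.2.le⟩

/-- The bivariate generating function `G_k(z,u) = ∑ z ^ |t| * u ^ leaves t`, the sum being over the
closed terms `t` with De Bruijn indices at most `k`: a power series in `z` whose coefficients are
polynomials in `u`. -/
noncomputable def genFun (k : ℕ) : PowerSeries ℕ[X] :=
  PowerSeries.mk fun n => ∑ t ∈ (finite_closedTerms k n).toFinset, (Polynomial.X : ℕ[X]) ^ t.leaves

/-- `c_1(u) = 1` and `c_j(u) = 4 (j - 1) u - 1 + 2 √(c_{j-1}(u))` for `j ≥ 2`,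
with the principal branch of the square root. The value at index `0` is never used. -/
noncomputable def c (u : ℂ) : ℕ → ℂ
  | 0 => 1
  | 1 => 1
  | j + 2 => 4 * ((j : ℂ) + 1) * u - 1 + 2 * Complex.sqrt (c u (j + 1))

end LambdaTerm

/-! Let `P_i` be the generating function of the terms that become closed under `i` further
abstractions. Splitting at the root gives `P_i = min(i,k) u z + z P_{i+1} + z P_i²`, and `P_{k+1} =
P_k` because indices are bounded by `k`. For `x_i = 2 z P_i` this reads `(1 - x_i)² = 1 - y_i` with
`y_i = 4 min(i,k) u z² + 2 z x_{i+1}`: nested square roots, from level `k` down to `G_k = P_0`.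

Put `z = ρ x` with `ρ = 1 / (1 + 2√(ku))`. At level `k` completing the square gives `x_k = 1 - ρ x -
√((1 - x)(1 - b x))` with `|b| < 1`, so the only singularity in the closed unit disc is the square
root at `x = 1`. At a lower level, `y_i(1) = 1 - ρ² c_j` with `j = k - i + 1`; at `u = 1` the
coefficients of `y_i` are nonnegative with sum below 1, so the outer root creates no new
singularity. It multiplies the coefficient of the singular part by `1 / √c_j`, whence the product in
the theorem (`SingularBehaviour.step`).

Contour integration is replaced by estimates on coefficients. Series with coefficients `O(n^(-3/2))`
form an algebra (`HasDecay.mul`), stable under the subcritical root (`UnifDecay.of_quadratic`). The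
singular part is carried by the derivative, `x_i' = a + q (1 - x)^(-1/2)` with `a`, `q` of that
class; then the `n`-th coefficient of `x_i'` is `q(1) / √(π n) + O(1/n)`
(`norm_succ_mul_coeff_sub_le`). All constants are uniform near `u = 1`. -/

namespace LambdaTerm

/-! ### The recursion for terms closed under `i` abstractions. -/

/-- Terms of size `n` with De Bruijn indices at most `k` that become closed under `i` further
abstractions. -/
def openTerms (k i n : ℕ) : Set LambdaTerm :=
  {t | t.ClosedUnder i ∧ t.IndicesLE k ∧ t.size = n}

theorem finite_openTerms (k i n : ℕ) : (openTerms k i n).Finite :=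
  (finite_indicesLE k n).subset fun _ h => ⟨h.2.1, h.2.2.le⟩

/-- The leaf polynomial of `openTerms k i n`, evaluated at `u`. -/
noncomputable def openPoly (k : ℕ) (u : ℂ) (i n : ℕ) : ℂ :=
  ∑ t ∈ (finite_openTerms k i n).toFinset, u ^ t.leaves

theorem aeval_coeff_genFun (k n : ℕ) (u : ℂ) :
    Polynomial.aeval u (PowerSeries.coeff n (genFun k)) = openPoly k u 0 n := by
  simp only [genFun, PowerSeries.coeff_mk, map_sum, map_pow, Polynomial.aeval_X, openPoly]
  -- `closedTerms k n` unfolds to `openTerms k 0 n`.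
  rfl

theorem continuous_openPoly (k i n : ℕ) : Continuous fun u => openPoly k u i n := by
  unfold openPoly
  fun_prop

theorem openPoly_one_nonneg (k i n : ℕ) : ∃ r : ℝ, 0 ≤ r ∧ openPoly k 1 i n = r :=
  ⟨(finite_openTerms k i n).toFinset.card, by positivity, by simp [openPoly]⟩

theorem openPoly_zero_left (u : ℂ) (i n : ℕ) : openPoly 0 u i n = 0 := by
  have h : ∀ t : LambdaTerm, ¬ t.IndicesLE 0 := by
    intro t
    induction t with
    | var i => simp [IndicesLE]
    | app s t hs ht => exact fun h => hs h.1
    | abs t ht => exact ht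
  refine Finset.sum_eq_zero fun t ht => ?_
  exact absurd ((finite_openTerms 0 i n).mem_toFinset.1 ht).2.1 (h t)

theorem IndicesLE.closedUnder {k d : ℕ} (hd : k ≤ d) {t : LambdaTerm} (h : t.IndicesLE k) :
    t.ClosedUnder d := by
  induction t generalizing d with
  | var i => exact le_trans h hd
  | app s t hs ht => exact ⟨hs hd h.1, ht hd h.2⟩
  | abs t ht => exact ht (by omega) h

/-- From depth `k` on, the bound on the indices already closes the term. This stops the recursion:
level `k` satisfies a quadratic equation involving itself only. -/
theorem openPoly_succ_of_le {k i : ℕ} (h : k ≤ i) (u : ℂ) (n : ℕ) :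
    openPoly k u (i + 1) n = openPoly k u i n := by
  have : openTerms k (i + 1) n = openTerms k i n := by
    ext t
    exact ⟨fun ht => ⟨ht.2.1.closedUnder h, ht.2⟩,
      fun ht => ⟨ht.2.1.closedUnder (by omega), ht.2⟩⟩
  unfold openPoly
  congr 1
  ext t
  simp [this]

theorem openPoly_size_zero (k i : ℕ) (u : ℂ) : openPoly k u i 0 = 0 := by
  refine Finset.sum_eq_zero fun t ht => ?_
  have := ((finite_openTerms k i 0).mem_toFinset.1 ht).2.2
  cases t <;> simp [size] at this

open Classical in
theorem openTerms_succ_toFinset (k i n : ℕ) :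
    (finite_openTerms k i (n + 1)).toFinset =
      ((if n = 0 then (Finset.range (min i k)).image fun j => var j.succPNat else ∅) ∪
        (finite_openTerms k (i + 1) n).toFinset.image abs) ∪
      (Finset.HasAntidiagonal.antidiagonal n).biUnion fun ab =>
        ((finite_openTerms k i ab.1).toFinset ×ˢ (finite_openTerms k i ab.2).toFinset).image
          fun st => app st.1 st.2 := by
  ext t
  simp only [Set.Finite.mem_toFinset, Finset.mem_union, Finset.mem_image, Finset.mem_biUnion,
    Finset.HasAntidiagonal.mem_antidiagonal, Finset.mem_product, Prod.exists]
  cases t with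
  | var j =>
    have hj : ∃ m : ℕ, j = m.succPNat := ⟨j.natPred, (PNat.succPNat_natPred j).symm⟩
    obtain ⟨m, rfl⟩ := hj
    by_cases hn : n = 0
    · simp [openTerms, ClosedUnder, IndicesLE, size, hn]
    · simp [openTerms, size, hn]
  | abs t => split_ifs <;> simp [openTerms, ClosedUnder, IndicesLE, size]
  | app s t =>
    have : ∀ x : LambdaTerm, x ∈ (if n = 0 then (Finset.range (min i k)).image
        (fun j => var j.succPNat) else ∅ : Finset LambdaTerm) → x ≠ app s t := by
      intro x hx
      split_ifs at hx
      · obtain ⟨j, -, rfl⟩ := Finset.mem_image.1 hx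
        simp
      · simp at hx
    have h' : app s t ∉ (if n = 0 then (Finset.range (min i k)).image
        (fun j => var j.succPNat) else ∅ : Finset LambdaTerm) := fun h => this _ h rfl
    simp only [h', false_or, openTerms, ClosedUnder, IndicesLE, size, Set.mem_ofPred_eq, reduceCtorEq,
      and_false, exists_false, app.injEq]
    constructor
    · rintro ⟨⟨h1, h2⟩, ⟨h3, h4⟩, h5⟩
      exact ⟨s.size, t.size, by omega, s, t, ⟨⟨h1, h3, rfl⟩, h2, h4, rfl⟩, rfl, rfl⟩
    · rintro ⟨a, b, hab, s, t, ⟨⟨h1, h3, rfl⟩, h2, h4, rfl⟩, rfl, rfl⟩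
      exact ⟨⟨h1, h2⟩, ⟨h3, h4⟩, by omega⟩

theorem openPoly_size_succ (k i n : ℕ) (u : ℂ) :
    openPoly k u i (n + 1) = (if n = 0 then (min i k : ℕ) * u else 0) + openPoly k u (i + 1) n +
      ∑ ab ∈ Finset.HasAntidiagonal.antidiagonal n, openPoly k u i ab.1 * openPoly k u i ab.2 := by
  classical
  rw [openPoly, openTerms_succ_toFinset, Finset.sum_union, Finset.sum_union, Finset.sum_biUnion]
  · congr 1
    · congr 1
      · split_ifs
        · rw [Finset.sum_image]
          · simp [leaves]
          · intro a _ b _ h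
            simpa using h
        · simp
      · rw [Finset.sum_image]
        · simp [leaves, openPoly]
        · intro a _ b _ h
          simpa using h
    · refine Finset.sum_congr rfl fun ab _ => ?_
      rw [Finset.sum_image, openPoly, openPoly, Finset.sum_mul_sum, Finset.sum_product]
      · simp [leaves, pow_add]
      · rintro ⟨a, b⟩ _ ⟨c, d⟩ _ h
        simpa using h
  · intro ab _ cd _ hne
    refine Finset.disjoint_left.2 fun t ht ht' => hne ?_
    simp only [Finset.mem_image, Finset.mem_product, Set.Finite.mem_toFinset] at ht ht'
    obtain ⟨⟨s, t⟩, ⟨h1, h2⟩, rfl⟩ := ht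
    obtain ⟨⟨s', t'⟩, ⟨h1', h2'⟩, h⟩ := ht'
    simp only [app.injEq] at h
    obtain ⟨rfl, rfl⟩ := h
    exact Prod.ext (h1.2.2.symm.trans h1'.2.2) (h2.2.2.symm.trans h2'.2.2)
  · refine Finset.disjoint_left.2 fun t ht ht' => ?_
    obtain ⟨s, -, rfl⟩ := Finset.mem_image.1 ht'
    split_ifs at ht <;> simp at ht
  · refine Finset.disjoint_left.2 fun t ht ht' => ?_
    simp only [Finset.mem_biUnion, Finset.mem_image] at ht'
    obtain ⟨ab, -, st, -, rfl⟩ := ht'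
    split_ifs at ht <;> simp at ht

end LambdaTerm

/-! ### The weights `(n + 1) ^ (-3 / 2)` and convolution sums. -/

section weights

/-- The weight `(n + 1) ^ (-3 / 2)`. -/
noncomputable def decayWeight (n : ℕ) : ℝ := (((n : ℝ) + 1) * √((n : ℝ) + 1))⁻¹

theorem decayWeight_pos (n : ℕ) : 0 < decayWeight n := by
  unfold decayWeight
  positivity

theorem decayWeight_zero : decayWeight 0 = 1 := by simp [decayWeight]

theorem succ_mul_decayWeight (n : ℕ) : ((n : ℝ) + 1) * decayWeight n = (√((n : ℝ) + 1))⁻¹ := by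
  unfold decayWeight
  field_simp

theorem inv_succ_le_two_mul {a n : ℕ} (h : n ≤ 2 * a) :
    ((a : ℝ) + 1)⁻¹ ≤ 2 * ((n : ℝ) + 1)⁻¹ := by
  have h' : (n : ℝ) ≤ 2 * a := by exact_mod_cast h
  rw [← div_eq_mul_inv, inv_eq_one_div, div_le_div_iff₀ (by positivity) (by positivity)]
  linarith

theorem inv_sqrt_succ_le_two_mul {a n : ℕ} (h : n ≤ 2 * a) :
    (√((a : ℝ) + 1))⁻¹ ≤ 2 * (√((n : ℝ) + 1))⁻¹ := by
  have h' : (n : ℝ) ≤ 2 * a := by exact_mod_cast h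
  rw [← div_eq_mul_inv, inv_eq_one_div, div_le_div_iff₀ (by positivity) (by positivity), one_mul]
  refine Real.sqrt_le_iff.2 ⟨by positivity, ?_⟩
  rw [mul_pow, Real.sq_sqrt (by positivity)]
  linarith

theorem decayWeight_eq (n : ℕ) : decayWeight n = ((n : ℝ) + 1)⁻¹ * (√((n : ℝ) + 1))⁻¹ := by
  rw [decayWeight, mul_inv]

theorem decayWeight_le_four_mul {a n : ℕ} (h : n ≤ 2 * a) :
    decayWeight a ≤ 4 * decayWeight n := by
  rw [decayWeight_eq, decayWeight_eq]
  calc _ ≤ (2 * ((n : ℝ) + 1)⁻¹) * (2 * (√((n : ℝ) + 1))⁻¹) :=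
        mul_le_mul (inv_succ_le_two_mul h) (inv_sqrt_succ_le_two_mul h) (by positivity)
          (by positivity)
    _ = _ := by ring

theorem decayWeight_le_sub (n : ℕ) :
    decayWeight n ≤ 4 * ((√((n : ℝ) + 1))⁻¹ - (√((n : ℝ) + 2))⁻¹) := by
  unfold decayWeight
  have hp2 : √((n : ℝ) + 1) ^ 2 = n + 1 := Real.sq_sqrt (by positivity)
  have hq2 : √((n : ℝ) + 2) ^ 2 = n + 2 := Real.sq_sqrt (by positivity)
  have hp : 0 < √((n : ℝ) + 1) := by positivity
  have hq : 0 < √((n : ℝ) + 2) := by positivity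
  have hn : (0 : ℝ) ≤ n := n.cast_nonneg
  set p := √((n : ℝ) + 1)
  set q := √((n : ℝ) + 2)
  -- Since `1/p - 1/q = 1 / (p q (p + q))`, the claim amounts to `q (p + q) ≤ 4 p²`; with `q ≤ 3p/2`
  -- the left side is at most `15/4 p²`.
  have hqp : q ≤ 3 / 2 * p := by
    refine (pow_le_pow_iff_left₀ hq.le (by positivity) two_ne_zero).1 ?_
    nlinarith
  have h1 : (n : ℝ) + 1 = p ^ 2 := hp2.symm
  rw [h1]
  have h2 : (q - p) * (q + p) = 1 := by nlinarith
  have h3 : q * (q + p) ≤ 4 * p ^ 2 := by nlinarith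
  have h4 : q ≤ 4 * p ^ 2 * (q - p) := by
    have : 0 < q - p := pos_of_mul_pos_left (by rw [h2]; exact one_pos) (by positivity)
    calc q = q * (q + p) * (q - p) := by linear_combination (-q) * h2
      _ ≤ _ := by gcongr
  have h5 : 4 * (p⁻¹ - q⁻¹) - (p ^ 2 * p)⁻¹ = (4 * p ^ 2 * (q - p) - q) / (p ^ 3 * q) := by
    field_simp
  have h6 : 0 ≤ (4 * p ^ 2 * (q - p) - q) / (p ^ 3 * q) :=
    div_nonneg (by linarith) (by positivity)
  linarith

theorem sum_range_decayWeight_add_le (m N : ℕ) :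
    ∑ n ∈ Finset.range N, decayWeight (m + n) ≤ 4 * (√((m : ℝ) + 1))⁻¹ := by
  have : ∑ n ∈ Finset.range N, decayWeight (m + n) ≤
      4 * (√((m : ℝ) + 1))⁻¹ - 4 * (√((m : ℝ) + N + 1))⁻¹ := by
    induction N with
    | zero => simp
    | succ N ih =>
      rw [Finset.sum_range_succ]
      have h := decayWeight_le_sub (m + N)
      push_cast at h ⊢
      rw [show (m : ℝ) + (N + 1) + 1 = m + N + 2 by ring]
      linarith
  have h : 0 < (√((m : ℝ) + N + 1))⁻¹ := by positivity
  linarith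

theorem sum_range_decayWeight_le (N : ℕ) : ∑ n ∈ Finset.range N, decayWeight n ≤ 4 := by
  simpa using sum_range_decayWeight_add_le 0 N

theorem summable_decayWeight : Summable decayWeight :=
  summable_of_sum_range_le (fun n => (decayWeight_pos n).le) sum_range_decayWeight_le

theorem tsum_decayWeight_add_le (m : ℕ) :
    ∑' n, decayWeight (n + m) ≤ 4 * (√((m : ℝ) + 1))⁻¹ := by
  refine Real.tsum_le_of_sum_range_le (fun n => (decayWeight_pos _).le) fun N => ?_
  simpa [add_comm] using sum_range_decayWeight_add_le m N

theorem sum_range_inv_sqrt_le (N : ℕ) :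
    ∑ n ∈ Finset.range N, (√((n : ℝ) + 1))⁻¹ ≤ 2 * √N := by
  induction N with
  | zero => simp
  | succ N ih =>
    rw [Finset.sum_range_succ]
    push_cast
    have hp2 : √((N : ℝ) + 1) ^ 2 = N + 1 := Real.sq_sqrt (by positivity)
    have hq2 : √(N : ℝ) ^ 2 = N := Real.sq_sqrt (by positivity)
    have hp : 0 < √((N : ℝ) + 1) := by positivity
    have h : (√((N : ℝ) + 1))⁻¹ ≤ 2 * (√((N : ℝ) + 1) - √N) := by
      rw [inv_le_iff_one_le_mul₀ hp]
      nlinarith [sq_nonneg (√((N : ℝ) + 1) - √N)]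
    linarith

/-- In `a + b = n` one index is at least `n / 2`: that factor is bounded by its maximum over the
upper half, the other one is summed. -/
theorem sum_antidiagonal_mul_le {F G : ℕ → ℝ} (hF : ∀ n, 0 ≤ F n) (hG : ∀ n, 0 ≤ G n) {n : ℕ}
    {SF SG MF MG : ℝ} (hMF : ∀ a ≤ n, n ≤ 2 * a → F a ≤ MF) (hMG : ∀ a ≤ n, n ≤ 2 * a → G a ≤ MG)
    (hSF : ∑ a ∈ Finset.range (n + 1), F a ≤ SF) (hSG : ∑ a ∈ Finset.range (n + 1), G a ≤ SG) :
    ∑ ab ∈ Finset.HasAntidiagonal.antidiagonal n, F ab.1 * G ab.2 ≤ MF * SG + SF * MG := by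
  have hMF0 : 0 ≤ MF := (hF n).trans (hMF n le_rfl (by omega))
  have hMG0 : 0 ≤ MG := (hG n).trans (hMG n le_rfl (by omega))
  calc ∑ ab ∈ Finset.HasAntidiagonal.antidiagonal n, F ab.1 * G ab.2
      ≤ ∑ ab ∈ Finset.HasAntidiagonal.antidiagonal n, (MF * G ab.2 + F ab.1 * MG) := by
        refine Finset.sum_le_sum fun ab hab => ?_
        have hab' := Finset.HasAntidiagonal.mem_antidiagonal.1 hab
        rcases le_total ab.1 ab.2 with h | h
        · have := mul_le_mul_of_nonneg_left (hMG ab.2 (by omega) (by omega)) (hF ab.1)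
          have := mul_nonneg hMF0 (hG ab.2)
          linarith
        · have := mul_le_mul_of_nonneg_right (hMF ab.1 (by omega) (by omega)) (hG ab.2)
          have := mul_nonneg (hF ab.1) hMG0
          linarith
    _ = MF * ∑ a ∈ Finset.range (n + 1), G a + (∑ a ∈ Finset.range (n + 1), F a) * MG := by
        rw [Finset.sum_add_distrib, ← Finset.mul_sum, ← Finset.sum_mul,
          Finset.Nat.sum_antidiagonal_eq_sum_range_succ_mk (fun ab => F ab.1),
          ← Finset.Nat.sum_antidiagonal_swap,
          Finset.Nat.sum_antidiagonal_eq_sum_range_succ_mk]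
        simp
    _ ≤ _ := by gcongr

end weights

/-! ### Power series with decaying or summable coefficients. -/

namespace PowerSeries

/-- The coefficients are bounded by `C (n + 1) ^ (-3 / 2)`. -/
def HasDecay (C : ℝ) (f : ℂ⟦X⟧) : Prop := ∀ n, ‖coeff n f‖ ≤ C * decayWeight n

/-- The `ℓ¹` norm of the sequence of coefficients is at most `M`. -/
def HasL1Bound (M : ℝ) (f : ℂ⟦X⟧) : Prop := ∀ N, ∑ n ∈ Finset.range N, ‖coeff n f‖ ≤ M

theorem HasDecay.nonneg {C : ℝ} {f : ℂ⟦X⟧} (h : HasDecay C f) : 0 ≤ C := by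
  simpa [decayWeight_zero] using (norm_nonneg _).trans (h 0)

theorem HasDecay.mono {C D : ℝ} {f : ℂ⟦X⟧} (h : HasDecay C f) (hCD : C ≤ D) : HasDecay D f :=
  fun n => (h n).trans (mul_le_mul_of_nonneg_right hCD (decayWeight_pos n).le)

theorem HasDecay.add {C D : ℝ} {f g : ℂ⟦X⟧} (hf : HasDecay C f) (hg : HasDecay D g) :
    HasDecay (C + D) (f + g) := fun n => by
  rw [map_add, add_mul]
  exact (norm_add_le _ _).trans (add_le_add (hf n) (hg n))

theorem HasDecay.sub {C D : ℝ} {f g : ℂ⟦X⟧} (hf : HasDecay C f) (hg : HasDecay D g) :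
    HasDecay (C + D) (f - g) := fun n => by
  rw [map_sub, add_mul]
  exact (norm_sub_le _ _).trans (add_le_add (hf n) (hg n))

theorem HasDecay.hasL1Bound {C : ℝ} {f : ℂ⟦X⟧} (h : HasDecay C f) : HasL1Bound (4 * C) f :=
  fun N => calc
    _ ≤ ∑ n ∈ Finset.range N, C * decayWeight n := Finset.sum_le_sum fun n _ => h n
    _ = C * ∑ n ∈ Finset.range N, decayWeight n := (Finset.mul_sum ..).symm
    _ ≤ C * 4 := mul_le_mul_of_nonneg_left (sum_range_decayWeight_le N) h.nonneg
    _ = _ := mul_comm ..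

theorem HasDecay.summable_norm {C : ℝ} {f : ℂ⟦X⟧} (h : HasDecay C f) :
    Summable fun n => ‖coeff n f‖ :=
  Summable.of_nonneg_of_le (fun _ => norm_nonneg _) h (summable_decayWeight.mul_left C)

theorem norm_coeff_mul_le (f g : ℂ⟦X⟧) (n : ℕ) :
    ‖coeff n (f * g)‖ ≤
      ∑ ab ∈ Finset.HasAntidiagonal.antidiagonal n, ‖coeff ab.1 f‖ * ‖coeff ab.2 g‖ := by
  rw [coeff_mul]
  exact (norm_sum_le _ _).trans_eq (Finset.sum_congr rfl fun _ _ => norm_mul _ _)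

/-- The larger index costs a factor 4 in the weight and the sum of weights is at most 4, so each of
the two halves contributes `16 C D`. -/
theorem HasDecay.mul {C D : ℝ} {f g : ℂ⟦X⟧} (hf : HasDecay C f) (hg : HasDecay D g) :
    HasDecay (32 * C * D) (f * g) := fun n => by
  refine (norm_coeff_mul_le f g n).trans <| (sum_antidiagonal_mul_le (fun _ => norm_nonneg _)
    (fun _ => norm_nonneg _) (MF := C * (4 * decayWeight n)) (MG := D * (4 * decayWeight n))
    (fun a _ ha => (hf a).trans (mul_le_mul_of_nonneg_left (decayWeight_le_four_mul ha) hf.nonneg))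
    (fun a _ ha => (hg a).trans (mul_le_mul_of_nonneg_left (decayWeight_le_four_mul ha) hg.nonneg))
    (hf.hasL1Bound _) (hg.hasL1Bound _)).trans_eq (by ring)

theorem HasL1Bound.nonneg {M : ℝ} {f : ℂ⟦X⟧} (h : HasL1Bound M f) : 0 ≤ M := by
  simpa using h 0

theorem sum_range_norm_coeff_mul_le (f g : ℂ⟦X⟧) (N : ℕ) :
    ∑ n ∈ Finset.range N, ‖coeff n (f * g)‖ ≤
      (∑ n ∈ Finset.range N, ‖coeff n f‖) * ∑ n ∈ Finset.range N, ‖coeff n g‖ := by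
  calc _ ≤ ∑ n ∈ Finset.range N, ∑ ab ∈ Finset.HasAntidiagonal.antidiagonal n,
          ‖coeff ab.1 f‖ * ‖coeff ab.2 g‖ := Finset.sum_le_sum fun n _ => norm_coeff_mul_le f g n
    _ = ∑ ab ∈ (Finset.range N).biUnion Finset.HasAntidiagonal.antidiagonal,
          ‖coeff ab.1 f‖ * ‖coeff ab.2 g‖ := by
        rw [Finset.sum_biUnion]
        intro a _ b _ hab
        refine Finset.disjoint_left.2 fun x hx hx' => hab ?_
        exact (Finset.HasAntidiagonal.mem_antidiagonal.1 hx).symm.trans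
          (Finset.HasAntidiagonal.mem_antidiagonal.1 hx')
    _ ≤ ∑ ab ∈ Finset.range N ×ˢ Finset.range N, ‖coeff ab.1 f‖ * ‖coeff ab.2 g‖ := by
        refine Finset.sum_le_sum_of_subset_of_nonneg ?_ fun _ _ _ => by positivity
        intro ab hab
        simp only [Finset.mem_biUnion, Finset.HasAntidiagonal.mem_antidiagonal, Finset.mem_range,
          Finset.mem_product] at hab ⊢
        omega
    _ = _ := by rw [Finset.sum_mul_sum, Finset.sum_product]

theorem HasL1Bound.mul {M L : ℝ} {f g : ℂ⟦X⟧} (hf : HasL1Bound M f) (hg : HasL1Bound L g) :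
    HasL1Bound (M * L) (f * g) := fun N =>
  (sum_range_norm_coeff_mul_le f g N).trans <|
    mul_le_mul (hf N) (hg N) (Finset.sum_nonneg fun _ _ => norm_nonneg _) hf.nonneg

theorem HasL1Bound.pow {M : ℝ} {f : ℂ⟦X⟧} (hf : HasL1Bound M f) (m : ℕ) :
    HasL1Bound (M ^ m) (f ^ m) := by
  induction m with
  | zero =>
    intro N
    simp only [pow_zero, coeff_one]
    calc _ = ∑ n ∈ Finset.range N, if n = 0 then (1 : ℝ) else 0 :=
          Finset.sum_congr rfl fun n _ => by split_ifs <;> simp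
      _ ≤ 1 := by rw [Finset.sum_ite_eq']; split_ifs <;> norm_num
  | succ m ih => exact pow_succ f m ▸ pow_succ M m ▸ ih.mul hf

/-- The root of `2 x = y + x ^ 2` without constant term is summable if `y` is, with norm `< 1`. -/
theorem HasL1Bound.of_quadratic {θ : ℝ} (hθ : θ < 1) {x y : ℂ⟦X⟧} (hy : HasL1Bound θ y)
    (hx0 : constantCoeff x = 0) (h : 2 * x = y + x ^ 2) : HasL1Bound (1 - √(1 - θ)) x := by
  have hs : √(1 - θ) ^ 2 = 1 - θ := Real.sq_sqrt (by linarith)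
  have hs0 := Real.sqrt_nonneg (1 - θ)
  have hs1 : √(1 - θ) ≤ 1 := Real.sqrt_le_one.2 (by linarith [hy.nonneg])
  intro N
  induction N with
  | zero => simpa using hs1
  | succ N ih =>
    obtain ⟨r, rfl⟩ : X ∣ x := X_dvd_iff.2 hx0
    set S := ∑ n ∈ Finset.range N, ‖coeff n (X * r)‖
    have hS0 : 0 ≤ S := Finset.sum_nonneg fun _ _ => norm_nonneg _
    -- As `x` has no constant term, its square up to degree `N` involves `x` only below degree `N`.
    -- Hence the partial norms satisfy `2 S_{N+1} ≤ θ + S_N²`, and `1 - √(1 - θ)` is a fixed point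
    -- of `s ↦ (θ + s²) / 2`.
    have h2 : ∑ n ∈ Finset.range (N + 1), ‖coeff n ((X * r) ^ 2)‖ ≤ S ^ 2 := by
      cases N with
      | zero => simp [sq_nonneg]
      | succ M =>
        have hrM : ∑ n ∈ Finset.range M, ‖coeff n r‖ = S := by
          simp only [S]
          rw [Finset.sum_range_succ']
          simp [coeff_succ_X_mul]
        have e : (X * r) ^ 2 = X * (X * (r * r)) := by ring
        rw [e, Finset.sum_range_succ', Finset.sum_range_succ']
        simp only [coeff_succ_X_mul, zero_add, coeff_zero_X_mul, norm_zero, add_zero]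
        rw [sq, ← hrM]
        exact sum_range_norm_coeff_mul_le r r M
    have h3 : 2 * ∑ n ∈ Finset.range (N + 1), ‖coeff n (X * r)‖ ≤ θ + S ^ 2 := by
      calc _ = ∑ n ∈ Finset.range (N + 1), ‖coeff n (2 * (X * r))‖ := by
            rw [Finset.mul_sum]
            refine Finset.sum_congr rfl fun n _ => ?_
            rw [show (2 : ℂ⟦X⟧) = C (2 : ℂ) from (map_ofNat C 2).symm, coeff_C_mul, norm_mul]
            simp
        _ ≤ ∑ n ∈ Finset.range (N + 1), (‖coeff n y‖ + ‖coeff n ((X * r) ^ 2)‖) := by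
            rw [h]
            refine Finset.sum_le_sum fun n _ => ?_
            rw [map_add]
            exact norm_add_le _ _
        _ ≤ _ := by
            rw [Finset.sum_add_distrib]
            exact add_le_add (hy _) h2
    nlinarith

/-- With `v = 1 + x v` and `x` divisible by `X`, the partial norms satisfy `S_{N+1} ≤ 1 + ξ S_N`,
whose fixed point is `1 / (1 - ξ)`. -/
theorem HasL1Bound.inv_one_sub {ξ : ℝ} (hξ : ξ < 1) {x : ℂ⟦X⟧} (hx : HasL1Bound ξ x)
    (hx0 : constantCoeff x = 0) : HasL1Bound (1 - ξ)⁻¹ (1 - x)⁻¹ := by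
  have hv : (1 - x)⁻¹ = 1 + x * (1 - x)⁻¹ := by
    have := PowerSeries.mul_inv_cancel (1 - x) (by simp [hx0])
    linear_combination this
  obtain ⟨r, hr⟩ : X ∣ x := X_dvd_iff.2 hx0
  set v := (1 - x)⁻¹
  intro N
  induction N with
  | zero => simpa using hξ.le
  | succ N ih =>
    have hrN : ∑ n ∈ Finset.range N, ‖coeff n r‖ ≤ ξ := by
      have := hx (N + 1)
      rw [Finset.sum_range_succ', hr] at this
      simpa [coeff_succ_X_mul] using this
    have h0 : coeff 0 v = 1 := by rw [hv, hr]; simp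
    rw [Finset.sum_range_succ', h0, norm_one]
    have hc : ∀ n, coeff (n + 1) v = coeff n (r * v) := fun n => by
      conv_lhs => rw [hv, hr, mul_assoc, map_add, coeff_succ_X_mul]
      simp [coeff_one]
    simp only [hc]
    have h1 := (sum_range_norm_coeff_mul_le r v N).trans <|
      mul_le_mul hrN ih (Finset.sum_nonneg fun _ _ => norm_nonneg _) hx.nonneg
    have h2 : 0 < 1 - ξ := by linarith
    have h3 : ξ * (1 - ξ)⁻¹ + 1 = (1 - ξ)⁻¹ := by field_simp; ring
    linarith

end PowerSeries

open Filter Topology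

/-! ### Stability of decay under subcritical square roots. -/

namespace PowerSeries

theorem HasDecay.norm_coeff_derivative_le {K : ℝ} {y : ℂ⟦X⟧} (hy : HasDecay K y) (n : ℕ) :
    ‖coeff n (d⁄dX ℂ y)‖ ≤ K * (√((n : ℝ) + 1))⁻¹ := by
  rw [coeff_derivative, norm_mul]
  have h1 : ‖((n : ℂ) + 1)‖ = (n : ℝ) + 1 := by
    exact_mod_cast Complex.norm_natCast (n + 1)
  have h2 := succ_mul_decayWeight (n + 1)
  push_cast at h2
  have h3 : (√((n : ℝ) + 1 + 1))⁻¹ ≤ (√((n : ℝ) + 1))⁻¹ := by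
    gcongr
    linarith
  rw [h1]
  calc _ ≤ K * decayWeight (n + 1) * ((n : ℝ) + 1) := by gcongr; exact hy _
    _ ≤ K * decayWeight (n + 1) * ((n : ℝ) + 1 + 1) := by
        gcongr
        · exact mul_nonneg hy.nonneg (decayWeight_pos _).le
        · linarith
    _ = K * (((n : ℝ) + 1 + 1) * decayWeight (n + 1)) := by ring
    _ ≤ _ := by
        rw [h2]
        exact mul_le_mul_of_nonneg_left h3 hy.nonneg

theorem norm_coeff_succ_eq (f : ℂ⟦X⟧) (n : ℕ) :
    ‖coeff (n + 1) f‖ = ‖coeff n (d⁄dX ℂ f)‖ * ((n : ℝ) + 1)⁻¹ := by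
  rw [coeff_derivative, norm_mul]
  have h1 : ‖((n : ℂ) + 1)‖ = (n : ℝ) + 1 := by
    exact_mod_cast Complex.norm_natCast (n + 1)
  rw [h1]
  field_simp

/-- Bounded times summable is bounded, so `f'` has bounded coefficients; integration gains `1 / n`.
-/
theorem norm_coeff_le_inv_of_derivative_eq {K M : ℝ} {α : ℂ} {f h y : ℂ⟦X⟧}
    (hf : d⁄dX ℂ f = C α * (h * d⁄dX ℂ y)) (hy : HasDecay K y) (hh : HasL1Bound M h) (n : ℕ) :
    ‖coeff n f‖ ≤ (‖coeff 0 f‖ + 2 * (‖α‖ * (K * M))) * ((n : ℝ) + 1)⁻¹ := by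
  have hK := hy.nonneg
  have hM := hh.nonneg
  cases n with
  | zero =>
    have : 0 ≤ 2 * (‖α‖ * (K * M)) := by positivity
    simpa using this
  | succ n =>
    rw [norm_coeff_succ_eq]
    have h1 : ‖coeff n (d⁄dX ℂ f)‖ ≤ ‖α‖ * (K * M) := by
      rw [hf, coeff_C_mul, norm_mul, mul_comm h]
      refine mul_le_mul_of_nonneg_left ?_ (norm_nonneg _)
      calc _ ≤ _ := norm_coeff_mul_le _ _ n
        _ ≤ ∑ ab ∈ Finset.HasAntidiagonal.antidiagonal n, K * ‖coeff ab.2 h‖ := by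
            refine Finset.sum_le_sum fun ab _ => mul_le_mul_of_nonneg_right ?_ (norm_nonneg _)
            refine (hy.norm_coeff_derivative_le _).trans (mul_le_of_le_one_right hK ?_)
            refine inv_le_one_of_one_le₀ (Real.one_le_sqrt.2 ?_)
            linarith [ab.1.cast_nonneg (α := ℝ)]
        _ = K * ∑ a ∈ Finset.range (n + 1), ‖coeff a h‖ := by
            rw [← Finset.mul_sum, ← Finset.Nat.sum_antidiagonal_swap,
              Finset.Nat.sum_antidiagonal_eq_sum_range_succ_mk]
            simp
        _ ≤ _ := mul_le_mul_of_nonneg_left (hh _) hK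
    have h3 : ((n : ℝ) + 1)⁻¹ ≤ 2 * ((n : ℝ) + 1 + 1)⁻¹ := by
      rw [← div_eq_mul_inv, inv_eq_one_div, div_le_div_iff₀ (by positivity) (by positivity)]
      linarith [n.cast_nonneg (α := ℝ)]
    push_cast
    calc _ ≤ (‖α‖ * (K * M)) * (2 * ((n : ℝ) + 1 + 1)⁻¹) := by gcongr
      _ = (0 + 2 * (‖α‖ * (K * M))) * ((n : ℝ) + 1 + 1)⁻¹ := by ring
      _ ≤ _ := by gcongr; exact norm_nonneg _

theorem decayWeight_le_four_mul_succ (n : ℕ) : decayWeight n ≤ 4 * decayWeight (n + 1) := by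
  cases n with
  | zero =>
    have h : √(2 : ℝ) ≤ 2 := Real.sqrt_le_iff.2 ⟨by norm_num, by norm_num⟩
    have h1 : decayWeight (0 + 1) = (2 * √2)⁻¹ := by norm_num [decayWeight]
    rw [decayWeight_zero, h1, ← div_eq_mul_inv, le_div_iff₀ (by positivity)]
    linarith
  | succ n => exact decayWeight_le_four_mul (by omega)

/-- Transfer of decay through the differential equation `f' = α g y'`. -/
theorem HasDecay.of_derivative_eq {K M D : ℝ} {α : ℂ} {f g y : ℂ⟦X⟧}
    (hf : d⁄dX ℂ f = C α * (g * d⁄dX ℂ y)) (hy : HasDecay K y) (hg : HasL1Bound M g)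
    (hg' : ∀ n, ‖coeff n g‖ ≤ D * ((n : ℝ) + 1)⁻¹) :
    HasDecay (‖coeff 0 f‖ + 4 * (‖α‖ * (K * (2 * M + 4 * D)))) f := by
  have hK := hy.nonneg
  have hM := hg.nonneg
  have hD : 0 ≤ D := by simpa using (norm_nonneg _).trans (hg' 0)
  intro n
  cases n with
  | zero =>
    have : 0 ≤ 4 * (‖α‖ * (K * (2 * M + 4 * D))) := by positivity
    simpa [decayWeight_zero] using this
  | succ n =>
    rw [norm_coeff_succ_eq]
    have h1 : ‖coeff n (d⁄dX ℂ f)‖ ≤ ‖α‖ * (K * (2 * M + 4 * D) * (√((n : ℝ) + 1))⁻¹) := by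
      rw [hf, coeff_C_mul, norm_mul, mul_comm g]
      refine mul_le_mul_of_nonneg_left ?_ (norm_nonneg _)
      -- The coefficients of `y'` are `O(n^(-1/2))` with partial sums `O(√n)`; those of `g` are
      -- `O(1/n)` with bounded sums. Both halves of the convolution are therefore `O(n^(-1/2))`.
      refine (norm_coeff_mul_le _ _ n).trans <| (sum_antidiagonal_mul_le
        (F := fun a => ‖coeff a (d⁄dX ℂ y)‖) (G := fun a => ‖coeff a g‖) (fun _ => norm_nonneg _)
        (fun _ => norm_nonneg _) (MF := K * (2 * (√((n : ℝ) + 1))⁻¹))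
        (MG := D * (2 * ((n : ℝ) + 1)⁻¹)) (SF := K * (2 * √((n : ℝ) + 1))) ?_ ?_ ?_
        (hg _)).trans_eq ?_
      · exact fun a _ ha => (hy.norm_coeff_derivative_le a).trans <|
          mul_le_mul_of_nonneg_left (inv_sqrt_succ_le_two_mul ha) hK
      · exact fun a _ ha => (hg' a).trans <|
          mul_le_mul_of_nonneg_left (inv_succ_le_two_mul ha) hD
      · calc _ ≤ ∑ a ∈ Finset.range (n + 1), K * (√((a : ℝ) + 1))⁻¹ :=
              Finset.sum_le_sum fun a _ => hy.norm_coeff_derivative_le a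
          _ = K * ∑ a ∈ Finset.range (n + 1), (√((a : ℝ) + 1))⁻¹ := (Finset.mul_sum ..).symm
          _ ≤ _ := by
              refine mul_le_mul_of_nonneg_left ?_ hK
              simpa using sum_range_inv_sqrt_le (n + 1)
      · have hn2 : √((n : ℝ) + 1) * ((n : ℝ) + 1)⁻¹ = (√((n : ℝ) + 1))⁻¹ := by
          rw [← div_eq_mul_inv, Real.sqrt_div_self]
        linear_combination (4 * K * D) * hn2
    calc _ ≤ ‖α‖ * (K * (2 * M + 4 * D) * (√((n : ℝ) + 1))⁻¹) * ((n : ℝ) + 1)⁻¹ := by gcongr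
      _ = (‖α‖ * (K * (2 * M + 4 * D))) * decayWeight n := by rw [decayWeight_eq]; ring
      _ ≤ (‖α‖ * (K * (2 * M + 4 * D))) * (4 * decayWeight (n + 1)) :=
          mul_le_mul_of_nonneg_left (decayWeight_le_four_mul_succ n) (by positivity)
      _ = (0 + 4 * (‖α‖ * (K * (2 * M + 4 * D)))) * decayWeight (n + 1) := by ring
      _ ≤ _ := by
          gcongr
          · exact (decayWeight_pos _).le
          · exact norm_nonneg _

section eval

/-- The value at `1`, as the sum of the coefficients. -/
noncomputable def evalOne (f : ℂ⟦X⟧) : ℂ := ∑' n, coeff n f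

variable {K L : ℝ} {f g : ℂ⟦X⟧}

theorem HasDecay.summable (hf : HasDecay K f) : Summable fun n => coeff n f :=
  hf.summable_norm.of_norm

theorem HasDecay.evalOne_add (hf : HasDecay K f) (hg : HasDecay L g) :
    evalOne (f + g) = evalOne f + evalOne g := by
  simpa [evalOne] using hf.summable.tsum_add hg.summable

theorem HasDecay.evalOne_sub (hf : HasDecay K f) (hg : HasDecay L g) :
    evalOne (f - g) = evalOne f - evalOne g := by
  simpa [evalOne] using hf.summable.tsum_sub hg.summable

theorem HasDecay.evalOne_mul (hf : HasDecay K f) (hg : HasDecay L g) :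
    evalOne (f * g) = evalOne f * evalOne g := by
  simp only [evalOne, coeff_mul]
  exact (tsum_mul_tsum_eq_tsum_sum_antidiagonal_of_summable_norm hf.summable_norm
    hg.summable_norm).symm

theorem evalOne_C (a : ℂ) : evalOne (C a) = a := by
  rw [evalOne, tsum_eq_single 0 fun n hn => by simp [coeff_C, hn]]
  simp

theorem evalOne_one : evalOne 1 = 1 := by simpa using evalOne_C 1

theorem evalOne_X : evalOne X = 1 := by
  rw [evalOne, tsum_eq_single 1 fun n hn => by simp [coeff_X, hn]]
  simp

theorem HasL1Bound.norm_evalOne_le (hf : HasL1Bound K f) : ‖evalOne f‖ ≤ K := by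
  have hs : Summable fun n => ‖coeff n f‖ := summable_of_sum_range_le (fun _ => norm_nonneg _) hf
  exact (norm_tsum_le_tsum_norm hs).trans (Real.tsum_le_of_sum_range_le (fun _ => norm_nonneg _) hf)

theorem hasDecay_C (a : ℂ) : HasDecay ‖a‖ (C a) := fun n => by
  rcases eq_or_ne n 0 with rfl | h
  · simp [decayWeight_zero]
  · simpa [coeff_C, h] using mul_nonneg (norm_nonneg a) (decayWeight_pos n).le

theorem hasDecay_X : HasDecay 4 X := fun n => by
  rcases eq_or_ne n 1 with rfl | h
  · simpa [decayWeight_zero] using decayWeight_le_four_mul_succ 0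
  · simpa [coeff_X, h] using (decayWeight_pos n).le

end eval

section uniform

variable {ι : Type*} {l : Filter ι} {f g x y : ι → ℂ⟦X⟧}

/-- Along the filter, the coefficients are `O((n + 1) ^ (-3 / 2))` with a common constant. -/
def UnifDecay (l : Filter ι) (f : ι → ℂ⟦X⟧) : Prop := ∃ K, ∀ᶠ u in l, HasDecay K (f u)

theorem UnifDecay.add (hf : UnifDecay l f) (hg : UnifDecay l g) :
    UnifDecay l fun u => f u + g u := by
  obtain ⟨K, hK⟩ := hf
  obtain ⟨L, hL⟩ := hg
  exact ⟨K + L, by filter_upwards [hK, hL] with u h1 h2 using h1.add h2⟩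

theorem UnifDecay.sub (hf : UnifDecay l f) (hg : UnifDecay l g) :
    UnifDecay l fun u => f u - g u := by
  obtain ⟨K, hK⟩ := hf
  obtain ⟨L, hL⟩ := hg
  exact ⟨K + L, by filter_upwards [hK, hL] with u h1 h2 using h1.sub h2⟩

theorem UnifDecay.mul (hf : UnifDecay l f) (hg : UnifDecay l g) :
    UnifDecay l fun u => f u * g u := by
  obtain ⟨K, hK⟩ := hf
  obtain ⟨L, hL⟩ := hg
  exact ⟨32 * K * L, by filter_upwards [hK, hL] with u h1 h2 using h1.mul h2⟩

theorem unifDecay_C {a : ι → ℂ} {b : ℂ} (h : Tendsto a l (𝓝 b)) :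
    UnifDecay l fun u => C (a u) := by
  refine ⟨‖b‖ + 1, ?_⟩
  filter_upwards [h.norm.eventually (gt_mem_nhds (lt_add_one ‖b‖))] with u hu
  exact (hasDecay_C _).mono hu.le

theorem unifDecay_X : UnifDecay l fun _ => X := ⟨4, .of_forall fun _ => hasDecay_X⟩

theorem unifDecay_one : UnifDecay l fun _ => (1 : ℂ⟦X⟧) := by
  simpa using unifDecay_C (l := l) (tendsto_const_nhds (x := (1 : ℂ)))

/-- If the coefficients converge, under a uniform decay bound, so do their `ℓ¹` norms. -/
theorem UnifDecay.eventually_hasL1Bound (hf : UnifDecay l f) {f₀ : ℂ⟦X⟧}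
    (h : ∀ n, Tendsto (fun u => coeff n (f u)) l (𝓝 (coeff n f₀)))
    (h₀ : ∑' n, ‖coeff n f₀‖ < 1) : ∃ θ < 1, ∀ᶠ u in l, HasL1Bound θ (f u) := by
  obtain ⟨K, hK⟩ := hf
  have ht : Tendsto (fun u => ∑' n, ‖coeff n (f u)‖) l (𝓝 (∑' n, ‖coeff n f₀‖)) :=
    tendsto_tsum_of_dominated_convergence (summable_decayWeight.mul_left K) (fun n => (h n).norm)
      (by filter_upwards [hK] with u hu n using by simpa using hu n)
  obtain ⟨θ, hθ₀, hθ⟩ := exists_between h₀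
  refine ⟨θ, hθ, ?_⟩
  filter_upwards [ht.eventually (gt_mem_nhds hθ₀), hK] with u hu hKu N
  exact (hKu.summable_norm.sum_le_tsum _ fun _ _ => norm_nonneg _).trans hu.le

/-- Differentiating the equation gives `2 (1 - x) x' = y'`. The ladder of powers 1, 3, 5 of `(1 -
x)⁻¹` feeds the bootstrap in `UnifDecay.of_quadratic`. -/
theorem derivative_inv_one_sub_of_quadratic {x y : ℂ⟦X⟧} (hx0 : constantCoeff x = 0)
    (h : 2 * x = y + x ^ 2) :
    d⁄dX ℂ x = C (1 / 2 : ℂ) * ((1 - x)⁻¹ * d⁄dX ℂ y) ∧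
      d⁄dX ℂ (1 - x)⁻¹ = C (1 / 2 : ℂ) * ((1 - x)⁻¹ ^ 3 * d⁄dX ℂ y) ∧
      d⁄dX ℂ ((1 - x)⁻¹ ^ 3) = C (3 / 2 : ℂ) * ((1 - x)⁻¹ ^ 5 * d⁄dX ℂ y) := by
  have hv := PowerSeries.mul_inv_cancel (1 - x) (by simp [hx0])
  have hd := congrArg (d⁄dX ℂ) h
  have h2 : (2 : ℂ⟦X⟧) = C (2 : ℂ) := (map_ofNat C 2).symm
  have hhalf : C (1 / 2 : ℂ) * 2 = (1 : ℂ⟦X⟧) := by rw [h2, ← map_mul]; norm_num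
  have hthree : C (3 / 2 : ℂ) = 3 * C (1 / 2 : ℂ) := by
    rw [show (3 : ℂ⟦X⟧) = C (3 : ℂ) from (map_ofNat C 3).symm, ← map_mul]; norm_num
  rw [Derivation.leibniz, map_add, derivative_pow] at hd
  have hd2 : d⁄dX ℂ (2 : ℂ⟦X⟧) = 0 := by rw [h2, derivative_C]
  rw [hd2] at hd
  simp only [smul_eq_mul, mul_zero, add_zero, Nat.cast_ofNat, Nat.add_one_sub_one, pow_one] at hd
  set v := (1 - x)⁻¹
  have hx : d⁄dX ℂ x = C (1 / 2 : ℂ) * (v * d⁄dX ℂ y) := by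
    linear_combination (C (1 / 2 : ℂ) * v) * hd - (d⁄dX ℂ x) * hhalf -
      (C (1 / 2 : ℂ) * 2 * (d⁄dX ℂ x)) * hv
  have hv' : d⁄dX ℂ v = C (1 / 2 : ℂ) * (v ^ 3 * d⁄dX ℂ y) := by
    rw [derivative_inv', map_sub, derivative_one, hx]
    ring
  refine ⟨hx, hv', ?_⟩
  rw [derivative_pow, hv', hthree]
  push_cast
  ring

/-- Bootstrap for `v = (1 - x)⁻¹`: `v⁵` is summable, so `v³` has coefficients `O(1/n)` by its
differential equation, so `v` has coefficients `O(n^(-3/2))`. Finally `1 - x = (1 - y) v` brings the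
decay back to `x`. -/
theorem UnifDecay.of_quadratic (hy : UnifDecay l y) {θ : ℝ} (hθ : θ < 1)
    (hyθ : ∀ᶠ u in l, HasL1Bound θ (y u)) (hx0 : ∀ u, constantCoeff (x u) = 0)
    (h : ∀ᶠ u in l, 2 * x u = y u + x u ^ 2) :
    (UnifDecay l fun u => (1 - x u)⁻¹) ∧ UnifDecay l x ∧
      ∀ᶠ u in l, HasL1Bound (1 - √(1 - θ)) (x u) := by
  have hx1 : ∀ᶠ u in l, HasL1Bound (1 - √(1 - θ)) (x u) := by
    filter_upwards [hyθ, h] with u h1 h2 using h1.of_quadratic hθ (hx0 u) h2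
  have hξ : 1 - √(1 - θ) < 1 := by
    have : 0 < √(1 - θ) := Real.sqrt_pos.2 (by linarith)
    linarith
  have hv : UnifDecay l fun u => (1 - x u)⁻¹ := by
    obtain ⟨K, hK⟩ := hy
    set M := (1 - (1 - √(1 - θ)))⁻¹
    refine ⟨1 + 4 * (‖(1 / 2 : ℂ)‖ * (K * (2 * M ^ 3 +
      4 * (1 + 2 * (‖(3 / 2 : ℂ)‖ * (K * M ^ 5)))))), ?_⟩
    filter_upwards [hx1, h, hK] with u h1 h2 h3
    have h4 := h1.inv_one_sub hξ (hx0 u)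
    obtain ⟨-, h5, h6⟩ := derivative_inv_one_sub_of_quadratic (hx0 u) h2
    have h7 := HasDecay.of_derivative_eq h5 h3 (h4.pow 3)
      (norm_coeff_le_inv_of_derivative_eq h6 h3 (h4.pow 5))
    simp only [coeff_zero_eq_constantCoeff, map_pow, constantCoeff_inv, map_sub, map_one, hx0 u,
      sub_zero, inv_one, norm_one, one_pow] at h7
    exact h7
  refine ⟨hv, ?_, hx1⟩
  obtain ⟨K, hK⟩ := unifDecay_one.sub ((unifDecay_one.sub hy).mul hv)
  refine ⟨K, ?_⟩
  filter_upwards [hK, h] with u h1 h2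
  have hinv := PowerSeries.mul_inv_cancel (1 - x u) (by simp [hx0])
  have : x u = 1 - (1 - y u) * (1 - x u)⁻¹ := by
    linear_combination (1 - x u)⁻¹ * h2 + (1 - x u) * hinv
  rwa [this]

end uniform

end PowerSeries

/-! ### The coefficients of `(1 - x) ^ (-1 / 2)`. -/

/-- The coefficient `∏_{i < n} (2 i + 1) / (2 i + 2)` of `x ^ n` in `(1 - x) ^ (-1 / 2)`. -/
noncomputable def invSqrtCoeff (n : ℕ) : ℝ :=
  ∏ i ∈ Finset.range n, (2 * (i : ℝ) + 1) / (2 * i + 2)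

theorem invSqrtCoeff_zero : invSqrtCoeff 0 = 1 := by simp [invSqrtCoeff]

theorem invSqrtCoeff_succ (n : ℕ) :
    invSqrtCoeff (n + 1) = invSqrtCoeff n * ((2 * (n : ℝ) + 1) / (2 * n + 2)) :=
  Finset.prod_range_succ ..

theorem invSqrtCoeff_pos (n : ℕ) : 0 < invSqrtCoeff n :=
  Finset.prod_pos fun _ _ => by positivity

theorem invSqrtCoeff_sub_succ (n : ℕ) :
    invSqrtCoeff n - invSqrtCoeff (n + 1) = 1 / 2 * (invSqrtCoeff n * ((n : ℝ) + 1)⁻¹) := by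
  rw [invSqrtCoeff_succ]
  field_simp
  ring

theorem invSqrtCoeff_le (n : ℕ) : invSqrtCoeff n ≤ (√((n : ℝ) + 1))⁻¹ := by
  -- The left side is nonincreasing in `n` and equals 1 at `n = 0`.
  have h : invSqrtCoeff n ^ 2 * (n + 1) ≤ 1 := by
    induction n with
    | zero => simp [invSqrtCoeff_zero]
    | succ n ih =>
      rw [invSqrtCoeff_succ]
      push_cast
      calc _ = invSqrtCoeff n ^ 2 * (n + 1) *
            ((2 * (n : ℝ) + 1) ^ 2 * (n + 2) / ((2 * n + 2) ^ 2 * (n + 1))) := by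
            field_simp
            ring
        _ ≤ 1 * 1 := by
            refine mul_le_mul ih ?_ (by positivity) zero_le_one
            rw [div_le_one (by positivity)]
            nlinarith [n.cast_nonneg (α := ℝ)]
        _ = 1 := one_mul 1
  have hs : √((n : ℝ) + 1) ^ 2 = n + 1 := Real.sq_sqrt (by positivity)
  have hs0 : 0 < √((n : ℝ) + 1) := by positivity
  rw [← one_div, le_div_iff₀ hs0]
  rw [← hs, ← mul_pow] at h
  exact (sq_le_one_iff₀ (mul_pos (invSqrtCoeff_pos n) hs0).le).1 h

theorem invSqrtCoeff_sq_mul_wallis (n : ℕ) :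
    invSqrtCoeff n ^ 2 * (2 * n + 1) * Real.Wallis.W n = 1 := by
  induction n with
  | zero => simp [invSqrtCoeff_zero, Real.Wallis.W]
  | succ n ih =>
    rw [invSqrtCoeff_succ, Real.Wallis.W_succ]
    push_cast
    refine Eq.trans ?_ ih
    field_simp
    ring

/-- The two-sided bounds on the Wallis product enclose `π n T²` between `1 - 1/n` and `1`, where `T
= invSqrtCoeff n`. -/
theorem abs_invSqrtCoeff_sub_le {n : ℕ} (hn : 0 < n) :
    |invSqrtCoeff n - (√(Real.pi * n))⁻¹| ≤ (n : ℝ)⁻¹ := by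
  have hn1 : (1 : ℝ) ≤ n := by exact_mod_cast hn
  have hn' : (0 : ℝ) < n := by linarith
  have hpi := Real.pi_pos
  have hW := invSqrtCoeff_sq_mul_wallis n
  have h1 := Real.Wallis.W_le n
  have h2 := Real.Wallis.le_W n
  have hWp := Real.Wallis.W_pos n
  set W := Real.Wallis.W n
  have hT := invSqrtCoeff_pos n
  set T := invSqrtCoeff n
  have hs : √(Real.pi * n) ^ 2 = Real.pi * n := Real.sq_sqrt (by positivity)
  have hs0 : 0 < √(Real.pi * n) := by positivity
  have hs1 : 1 ≤ √(Real.pi * n) := by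
    rw [Real.one_le_sqrt]
    nlinarith [Real.pi_gt_three]
  set s := √(Real.pi * n)
  have hup : (s * T) ^ 2 ≤ 1 := by
    have : T ^ 2 * (2 * n + 1) * ((2 * n + 1) / (2 * n + 2) * (Real.pi / 2)) ≤ 1 :=
      (mul_le_mul_of_nonneg_left h2 (by positivity)).trans_eq hW
    have h3 : T ^ 2 * (2 * n + 1) * ((2 * n + 1) / (2 * n + 2) * (Real.pi / 2)) =
        (s * T) ^ 2 * ((2 * n + 1) ^ 2 / (4 * n * (n + 1))) := by
      rw [mul_pow, hs]
      field_simp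
      ring
    have h4 : 1 ≤ (2 * (n : ℝ) + 1) ^ 2 / (4 * n * (n + 1)) := by
      rw [one_le_div (by positivity)]
      nlinarith
    rw [h3] at this
    nlinarith [sq_nonneg (s * T)]
  have hlow : 1 - (n : ℝ)⁻¹ ≤ (s * T) ^ 2 := by
    have : 1 ≤ T ^ 2 * (2 * n + 1) * (Real.pi / 2) :=
      hW.symm.trans_le (mul_le_mul_of_nonneg_left h1 (by positivity))
    have h3 : T ^ 2 * (2 * n + 1) * (Real.pi / 2) = (s * T) ^ 2 * ((2 * n + 1) / (2 * n)) := by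
      rw [mul_pow, hs]
      field_simp
    have h4 : (2 * (n : ℝ) + 1) / (2 * n) = 1 + (n : ℝ)⁻¹ / 2 := by
      field_simp
    rw [h3, h4] at this
    have h5 : 0 < (n : ℝ)⁻¹ := by positivity
    nlinarith
  have hsT : 0 < s * T := by positivity
  have hsT1 : s * T ≤ 1 := (sq_le_one_iff₀ hsT.le).1 hup
  have h6 : 1 - s * T ≤ (n : ℝ)⁻¹ := by nlinarith
  have h7 : T - s⁻¹ = -((1 - s * T) * s⁻¹) := by
    field_simp
    ring
  rw [h7, abs_neg, abs_of_nonneg (mul_nonneg (by linarith) (by positivity))]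
  calc _ ≤ (n : ℝ)⁻¹ * 1 :=
        mul_le_mul h6 (inv_le_one_of_one_le₀ hs1) (by positivity) (by positivity)
    _ = _ := mul_one _

theorem decayWeight_antitone : Antitone decayWeight := fun a b h => by
  unfold decayWeight
  have : (a : ℝ) ≤ b := by exact_mod_cast h
  gcongr

theorem invSqrtCoeff_sub_add_le (a b : ℕ) :
    invSqrtCoeff b - invSqrtCoeff (a + b) ≤ 1 / 2 * (a * decayWeight b) := by
  induction a with
  | zero => simp
  | succ a ih =>
    have h1 := invSqrtCoeff_sub_succ (a + b)
    have h2 : invSqrtCoeff (a + b) * (((a + b : ℕ) : ℝ) + 1)⁻¹ ≤ decayWeight b := by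
      refine le_trans ?_ (decayWeight_antitone (Nat.le_add_left b a))
      rw [decayWeight_eq, mul_comm]
      exact mul_le_mul_of_nonneg_left (invSqrtCoeff_le _) (by positivity)
    rw [show a + 1 + b = a + b + 1 by ring]
    push_cast at h1 h2 ⊢
    linarith

theorem invSqrtCoeff_antitone : Antitone invSqrtCoeff :=
  antitone_nat_of_succ_le fun n => by
    have := invSqrtCoeff_sub_succ n
    have : 0 < 1 / 2 * (invSqrtCoeff n * ((n : ℝ) + 1)⁻¹) := by
      have := invSqrtCoeff_pos n
      positivity
    linarith

/-! ### The series `(1 - b x) ^ (± 1 / 2)` and transfer to coefficients. -/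

namespace PowerSeries

/-- The expansion of `(1 - b x) ^ (-1 / 2)`. -/
noncomputable def invSqrtSeries (b : ℂ) : ℂ⟦X⟧ := mk fun n => (invSqrtCoeff n : ℂ) * b ^ n

/-- The expansion of `(1 - b x) ^ (1 / 2)`. -/
noncomputable def sqrtSeries (b : ℂ) : ℂ⟦X⟧ := (1 - C b * X) * invSqrtSeries b

theorem coeff_invSqrtSeries (b : ℂ) (n : ℕ) :
    coeff n (invSqrtSeries b) = (invSqrtCoeff n : ℂ) * b ^ n := coeff_mk ..

theorem constantCoeff_invSqrtSeries (b : ℂ) : constantCoeff (invSqrtSeries b) = 1 := by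
  rw [← coeff_zero_eq_constantCoeff_apply, coeff_invSqrtSeries, invSqrtCoeff_zero]
  simp

theorem two_mul_derivative_invSqrtSeries (b : ℂ) :
    2 * ((1 - C b * X) * d⁄dX ℂ (invSqrtSeries b)) = C b * invSqrtSeries b := by
  rw [show (2 : ℂ⟦X⟧) = C (2 : ℂ) from (map_ofNat C 2).symm]
  ext n
  have hs := congrArg (fun x : ℝ => (x : ℂ)) (invSqrtCoeff_succ n)
  have hn : (2 * (n : ℂ) + 2) ≠ 0 := by exact_mod_cast (by omega : 2 * n + 2 ≠ 0)
  push_cast at hs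
  have hs' : (invSqrtCoeff (n + 1) : ℂ) * (2 * n + 2) = invSqrtCoeff n * (2 * n + 1) := by
    rw [hs]
    field_simp
  rw [coeff_C_mul, coeff_C_mul, sub_mul, one_mul, map_sub, mul_assoc, coeff_C_mul]
  cases n with
  | zero =>
    simp only [coeff_derivative, coeff_invSqrtSeries, coeff_zero_X_mul]
    push_cast at hs' ⊢
    linear_combination b * hs'
  | succ n =>
    simp only [coeff_derivative, coeff_invSqrtSeries, coeff_succ_X_mul]
    push_cast at hs' ⊢
    linear_combination b ^ (n + 2) * hs'

theorem derivative_sqrtSeries (b : ℂ) :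
    d⁄dX ℂ (sqrtSeries b) = C (-(b / 2)) * invSqrtSeries b := by
  have h := two_mul_derivative_invSqrtSeries b
  have hb : C b = 2 * C (b / 2) := by
    rw [show (2 : ℂ⟦X⟧) = C (2 : ℂ) from (map_ofNat C 2).symm, ← map_mul]
    congr 1
    ring
  have hhalf : C (1 / 2 : ℂ) * 2 = (1 : ℂ⟦X⟧) := by
    rw [show (2 : ℂ⟦X⟧) = C (2 : ℂ) from (map_ofNat C 2).symm, ← map_mul]; norm_num
  rw [sqrtSeries, Derivation.leibniz, map_sub, derivative_one, Derivation.leibniz, derivative_C,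
    derivative_X]
  simp only [smul_eq_mul, mul_zero, add_zero, mul_one, zero_sub, map_neg]
  linear_combination C (1 / 2 : ℂ) * h - ((1 - C b * X) * d⁄dX ℂ (invSqrtSeries b)) * hhalf +
    (C (1 / 2 : ℂ) * invSqrtSeries b - invSqrtSeries b) * hb +
    (C (b / 2) * invSqrtSeries b) * hhalf

/-- By the differential equation of `invSqrtSeries`, the product has derivative 0; its constant term
is 1. -/
theorem sqrtSeries_mul_invSqrtSeries (b : ℂ) : sqrtSeries b * invSqrtSeries b = 1 := by
  have h := two_mul_derivative_invSqrtSeries b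
  have h' := derivative_sqrtSeries b
  have hb : C b = 2 * C (b / 2) := by
    rw [show (2 : ℂ⟦X⟧) = C (2 : ℂ) from (map_ofNat C 2).symm, ← map_mul]
    congr 1
    ring
  have hhalf : C (1 / 2 : ℂ) * 2 = (1 : ℂ⟦X⟧) := by
    rw [show (2 : ℂ⟦X⟧) = C (2 : ℂ) from (map_ofNat C 2).symm, ← map_mul]; norm_num
  refine derivative.ext (R := ℂ) ?_ ?_
  · rw [Derivation.leibniz, derivative_one, h', map_neg]
    simp only [smul_eq_mul, sqrtSeries]
    linear_combination C (1 / 2 : ℂ) * invSqrtSeries b * h -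
      ((1 - C b * X) * d⁄dX ℂ (invSqrtSeries b) * invSqrtSeries b) * hhalf +
      C (1 / 2 : ℂ) * invSqrtSeries b ^ 2 * hb + C (b / 2) * invSqrtSeries b ^ 2 * hhalf
  · simp [sqrtSeries, constantCoeff_invSqrtSeries]

theorem sqrtSeries_sq (b : ℂ) : sqrtSeries b ^ 2 = 1 - C b * X := by
  have h := sqrtSeries_mul_invSqrtSeries b
  calc sqrtSeries b ^ 2 = (1 - C b * X) * (sqrtSeries b * invSqrtSeries b) := by
        rw [sq]; nth_rw 2 [sqrtSeries]; ring
    _ = _ := by rw [h, mul_one]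

theorem coeff_zero_sqrtSeries (b : ℂ) : coeff 0 (sqrtSeries b) = 1 := by
  simp [sqrtSeries, constantCoeff_invSqrtSeries]

theorem norm_coeff_succ_sqrtSeries (b : ℂ) (n : ℕ) :
    ‖coeff (n + 1) (sqrtSeries b)‖ =
      (invSqrtCoeff n - invSqrtCoeff (n + 1)) * ‖b‖ ^ (n + 1) := by
  rw [norm_coeff_succ_eq, derivative_sqrtSeries, coeff_C_mul, coeff_invSqrtSeries,
    invSqrtCoeff_sub_succ]
  simp only [norm_mul, norm_neg, norm_div, norm_pow, Complex.norm_real, Real.norm_eq_abs,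
    abs_of_pos (invSqrtCoeff_pos n)]
  norm_num
  ring

theorem hasDecay_sqrtSeries {b : ℂ} (hb : ‖b‖ ≤ 1) : HasDecay 2 (sqrtSeries b) := fun n => by
  cases n with
  | zero => rw [coeff_zero_sqrtSeries]; norm_num [decayWeight_zero]
  | succ n =>
    rw [norm_coeff_succ_sqrtSeries, invSqrtCoeff_sub_succ]
    have h1 : invSqrtCoeff n * ((n : ℝ) + 1)⁻¹ ≤ decayWeight n := by
      rw [decayWeight_eq, mul_comm]
      exact mul_le_mul_of_nonneg_left (invSqrtCoeff_le _) (by positivity)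
    have h2 := decayWeight_le_four_mul_succ n
    have h3 : 0 < invSqrtCoeff n := invSqrtCoeff_pos n
    calc _ ≤ 1 / 2 * (invSqrtCoeff n * ((n : ℝ) + 1)⁻¹) * 1 :=
          mul_le_mul_of_nonneg_left (pow_le_one₀ (norm_nonneg _) hb) (by positivity)
      _ ≤ _ := by linarith

/-- The geometric factor absorbs any power of `n`; here `(n + 1) βⁿ ≤ 1 + β + ⋯ + βⁿ` suffices. It
serves for the conjugate singularity. -/
theorem hasDecay_invSqrtSeries {b : ℂ} {β : ℝ} (hb : ‖b‖ ≤ β) (hβ : β < 1) :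
    HasDecay (1 - β)⁻¹ (invSqrtSeries b) := fun n => by
  have hβ0 : 0 ≤ β := (norm_nonneg b).trans hb
  have h1 : ((n : ℝ) + 1) * β ^ n ≤ (1 - β)⁻¹ := by
    calc ((n : ℝ) + 1) * β ^ n = ∑ i ∈ Finset.range (n + 1), β ^ n := by simp
      _ ≤ ∑ i ∈ Finset.range (n + 1), β ^ i := Finset.sum_le_sum fun i hi =>
          pow_le_pow_of_le_one hβ0 hβ.le (by have := Finset.mem_range.1 hi; omega)
      _ ≤ ∑' i, β ^ i := (summable_geometric_of_lt_one hβ0 hβ).sum_le_tsum _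
          fun _ _ => by positivity
      _ = _ := tsum_geometric_of_lt_one hβ0 hβ
  have hpos := decayWeight_pos n
  rw [coeff_invSqrtSeries, norm_mul, norm_pow, Complex.norm_real, Real.norm_eq_abs,
    abs_of_pos (invSqrtCoeff_pos n)]
  calc _ ≤ (√((n : ℝ) + 1))⁻¹ * β ^ n :=
        mul_le_mul (invSqrtCoeff_le n) (pow_le_pow_left₀ (norm_nonneg _) hb n) (by positivity)
          (by positivity)
    _ = ((n : ℝ) + 1) * β ^ n * decayWeight n := by
        rw [← succ_mul_decayWeight]; ring
    _ ≤ _ := by gcongr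

theorem evalOne_sqrtSeries_sq {b : ℂ} (hb : ‖b‖ ≤ 1) : evalOne (sqrtSeries b) ^ 2 = 1 - b := by
  have h := hasDecay_sqrtSeries hb
  rw [sq, ← h.evalOne_mul h, ← sq, sqrtSeries_sq]
  have h1 : HasDecay ‖(1 : ℂ)‖ 1 := by simpa using hasDecay_C 1
  rw [h1.evalOne_sub ((hasDecay_C b).mul hasDecay_X), (hasDecay_C b).evalOne_mul hasDecay_X,
    evalOne_one, evalOne_C, evalOne_X, mul_one]

/-- The norms of the nonconstant coefficients telescope to at most `‖b‖ < 1`. This identifies the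
value as the principal root of `1 - b`. -/
theorem re_evalOne_sqrtSeries_pos {b : ℂ} (hb : ‖b‖ < 1) : 0 < (evalOne (sqrtSeries b)).re := by
  have h := hasDecay_sqrtSeries hb.le
  have h1 : evalOne (sqrtSeries b) = 1 + ∑' n, coeff (n + 1) (sqrtSeries b) := by
    rw [evalOne, h.summable.tsum_eq_zero_add, coeff_zero_sqrtSeries]
  have hs : ∀ N, ∑ n ∈ Finset.range N, ‖coeff (n + 1) (sqrtSeries b)‖ ≤ ‖b‖ := fun N => by
    calc _ ≤ ∑ n ∈ Finset.range N, (invSqrtCoeff n - invSqrtCoeff (n + 1)) * ‖b‖ := by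
          refine Finset.sum_le_sum fun n _ => ?_
          rw [norm_coeff_succ_sqrtSeries]
          refine mul_le_mul_of_nonneg_left ?_
            (sub_nonneg.2 (invSqrtCoeff_antitone (Nat.le_succ n)))
          exact pow_le_of_le_one (norm_nonneg _) hb.le (Nat.succ_ne_zero n)
      _ = (1 - invSqrtCoeff N) * ‖b‖ := by
          rw [← Finset.sum_mul, Finset.sum_range_sub', invSqrtCoeff_zero]
      _ ≤ 1 * ‖b‖ := by
          gcongr
          linarith [invSqrtCoeff_pos N]
      _ = _ := one_mul _
  have hsum := summable_of_sum_range_le (fun _ => norm_nonneg _) hs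
  have h2 : ‖∑' n, coeff (n + 1) (sqrtSeries b)‖ ≤ ‖b‖ :=
    (norm_tsum_le_tsum_norm hsum).trans (Real.tsum_le_of_sum_range_le (fun _ => norm_nonneg _) hs)
  have h3 := (Complex.abs_re_le_norm _).trans h2
  rw [h1, Complex.add_re, Complex.one_re]
  linarith [(abs_le.1 h3).1]

/-- When the first index `a` is the smaller one, the difference is `O(a n^(-3/2))` and the decay of
`q` at `a` leaves `O(n^(-3/2) a^(-1/2))`. Otherwise `q` itself supplies `n^(-3/2)`. Summing inverse
square roots costs `√n`. -/
theorem HasDecay.norm_sum_coeff_mul_invSqrtCoeff_sub_le {K : ℝ} {q : ℂ⟦X⟧} (hq : HasDecay K q)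
    (n : ℕ) :
    ‖∑ ab ∈ Finset.HasAntidiagonal.antidiagonal n,
      coeff ab.1 q * ((invSqrtCoeff ab.2 - invSqrtCoeff n : ℝ) : ℂ)‖ ≤
      16 * K * ((n : ℝ) + 1)⁻¹ := by
  have hK := hq.nonneg
  have hrange' : ∑ ab ∈ Finset.HasAntidiagonal.antidiagonal n, (√((ab.1 : ℝ) + 1))⁻¹ ≤
      2 * √((n : ℝ) + 1) := by
    rw [Finset.Nat.sum_antidiagonal_eq_sum_range_succ_mk]
    simpa using sum_range_inv_sqrt_le (n + 1)
  have hrange'' : ∑ ab ∈ Finset.HasAntidiagonal.antidiagonal n, (√((ab.2 : ℝ) + 1))⁻¹ ≤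
      2 * √((n : ℝ) + 1) := by
    rw [← Finset.Nat.sum_antidiagonal_swap]
    exact hrange'
  calc _ ≤ ∑ ab ∈ Finset.HasAntidiagonal.antidiagonal n,
        4 * K * decayWeight n * ((√((ab.1 : ℝ) + 1))⁻¹ + (√((ab.2 : ℝ) + 1))⁻¹) := by
        refine (norm_sum_le _ _).trans (Finset.sum_le_sum fun ab hab => ?_)
        have hab' : ab.1 + ab.2 = n := Finset.HasAntidiagonal.mem_antidiagonal.1 hab
        have h0 : 0 ≤ invSqrtCoeff ab.2 - invSqrtCoeff n :=
          sub_nonneg.2 (invSqrtCoeff_antitone (by omega))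
        have hw := decayWeight_pos n
        have hqa := hq ab.1
        rw [norm_mul, Complex.norm_real, Real.norm_eq_abs, abs_of_nonneg h0]
        rcases le_total ab.1 ab.2 with h | h
        · have h1 := invSqrtCoeff_sub_add_le ab.1 ab.2
          rw [hab'] at h1
          have h2 := decayWeight_le_four_mul (a := ab.2) (n := n) (by omega)
          have h3 := succ_mul_decayWeight ab.1
          have hwa := decayWeight_pos ab.1
          calc _ ≤ K * decayWeight ab.1 * (1 / 2 * (ab.1 * (4 * decayWeight n))) := by
                refine mul_le_mul hqa (h1.trans ?_) h0 (by positivity)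
                gcongr
            _ = 2 * K * decayWeight n * (ab.1 * decayWeight ab.1) := by ring
            _ ≤ 4 * K * decayWeight n * (((ab.1 : ℝ) + 1) * decayWeight ab.1) := by
                gcongr <;> linarith
            _ ≤ _ := by
                rw [h3]
                gcongr
                have : 0 ≤ (√((ab.2 : ℝ) + 1))⁻¹ := by positivity
                linarith
        · have h2 := decayWeight_le_four_mul (a := ab.1) (n := n) (by omega)
          have h3 := invSqrtCoeff_le ab.2
          have h4 := invSqrtCoeff_pos n
          calc _ ≤ K * (4 * decayWeight n) * (√((ab.2 : ℝ) + 1))⁻¹ := by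
                refine mul_le_mul (hqa.trans ?_) (by linarith) h0 (by positivity)
                gcongr
            _ = 4 * K * decayWeight n * (√((ab.2 : ℝ) + 1))⁻¹ := by ring
            _ ≤ _ := by
                gcongr
                have : 0 ≤ (√((ab.1 : ℝ) + 1))⁻¹ := by positivity
                linarith
    _ ≤ 4 * K * decayWeight n * (2 * √((n : ℝ) + 1) + 2 * √((n : ℝ) + 1)) := by
        have hw := decayWeight_pos n
        rw [← Finset.mul_sum, Finset.sum_add_distrib]
        gcongr
    _ = _ := by
        have : (0 : ℝ) < √((n : ℝ) + 1) := by positivity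
        rw [decayWeight_eq]
        field_simp
        ring

theorem HasDecay.norm_tail_mul_invSqrtCoeff_le {K : ℝ} {q : ℂ⟦X⟧} (hq : HasDecay K q)
    (n : ℕ) :
    ‖(∑' m, coeff (m + (n + 1)) q) * invSqrtCoeff n‖ ≤ 4 * K * ((n : ℝ) + 1)⁻¹ := by
  have hK := hq.nonneg
  have hsum : Summable fun m => ‖coeff (m + (n + 1)) q‖ :=
    (summable_nat_add_iff (f := fun m => ‖coeff m q‖) (n + 1)).2 hq.summable_norm
  have hsw : Summable fun m => K * decayWeight (m + (n + 1)) :=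
    ((summable_nat_add_iff (f := decayWeight) (n + 1)).2 summable_decayWeight).mul_left K
  have h0 : ∑' m, decayWeight (m + (n + 1)) ≤ 4 * (√((n : ℝ) + 1))⁻¹ := by
    refine (tsum_decayWeight_add_le (n + 1)).trans ?_
    have : √((n : ℝ) + 1) ≤ √(((n + 1 : ℕ) : ℝ) + 1) := Real.sqrt_le_sqrt (by push_cast; linarith)
    gcongr
  have h1 : ‖∑' m, coeff (m + (n + 1)) q‖ ≤ K * (4 * (√((n : ℝ) + 1))⁻¹) := by
    refine (norm_tsum_le_tsum_norm hsum).trans ?_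
    refine (hsum.tsum_le_tsum (fun m => hq (m + (n + 1))) hsw).trans ?_
    rw [tsum_mul_left]
    exact mul_le_mul_of_nonneg_left h0 hK
  rw [norm_mul, Complex.norm_real, Real.norm_eq_abs, abs_of_pos (invSqrtCoeff_pos n)]
  have hs : (√((n : ℝ) + 1))⁻¹ * (√((n : ℝ) + 1))⁻¹ = ((n : ℝ) + 1)⁻¹ := by
    rw [← mul_inv, Real.mul_self_sqrt (by positivity)]
  calc _ ≤ K * (4 * (√((n : ℝ) + 1))⁻¹) * (√((n : ℝ) + 1))⁻¹ :=
        mul_le_mul h1 (invSqrtCoeff_le n) (invSqrtCoeff_pos n).le (by positivity)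
    _ = _ := by rw [← hs]; ring

/-- The coefficients of `q(x) (1 - x) ^ (-1 / 2)` are asymptotic to those of
`q(1) (1 - x) ^ (-1 / 2)`. -/
theorem HasDecay.norm_coeff_mul_invSqrtSeries_sub_le {K : ℝ} {q : ℂ⟦X⟧} (hq : HasDecay K q)
    (n : ℕ) :
    ‖coeff n (q * invSqrtSeries 1) - evalOne q * invSqrtCoeff n‖ ≤ 20 * K * ((n : ℝ) + 1)⁻¹ := by
  have hsplit : evalOne q = ∑ a ∈ Finset.range (n + 1), coeff a q + ∑' m, coeff (m + (n + 1)) q :=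
    (hq.summable.sum_add_tsum_nat_add (n + 1)).symm
  have hrange : ∑ a ∈ Finset.range (n + 1), coeff a q =
      ∑ ab ∈ Finset.HasAntidiagonal.antidiagonal n, coeff ab.1 q := by
    rw [Finset.Nat.sum_antidiagonal_eq_sum_range_succ_mk]
  have heq : coeff n (q * invSqrtSeries 1) - evalOne q * invSqrtCoeff n =
      ∑ ab ∈ Finset.HasAntidiagonal.antidiagonal n,
        coeff ab.1 q * ((invSqrtCoeff ab.2 - invSqrtCoeff n : ℝ) : ℂ) -
      (∑' m, coeff (m + (n + 1)) q) * invSqrtCoeff n := by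
    rw [hsplit, hrange, coeff_mul, add_mul, Finset.sum_mul, ← sub_sub, ← Finset.sum_sub_distrib]
    congr 1
    refine Finset.sum_congr rfl fun ab _ => ?_
    rw [coeff_invSqrtSeries]
    push_cast
    ring
  rw [heq]
  exact (norm_sub_le _ _).trans ((add_le_add (hq.norm_sum_coeff_mul_invSqrtCoeff_sub_le n)
    (hq.norm_tail_mul_invSqrtCoeff_le n)).trans_eq (by ring))

/-- Coefficient asymptotics of a series with derivative `a(x) + q(x) (1 - x) ^ (-1 / 2)`. -/
theorem norm_succ_mul_coeff_sub_le {K L : ℝ} {f a q : ℂ⟦X⟧} (ha : HasDecay K a)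
    (hq : HasDecay L q) (hf : d⁄dX ℂ f = a + q * invSqrtSeries 1) {n : ℕ} (hn : 0 < n) :
    ‖((n : ℂ) + 1) * coeff (n + 1) f - evalOne q * ((√(Real.pi * n))⁻¹ : ℝ)‖ ≤
      (K + 20 * L + 4 * L) * (n : ℝ)⁻¹ := by
  have hK := ha.nonneg
  have hL := hq.nonneg
  have hn' : (0 : ℝ) < n := by exact_mod_cast hn
  have h1 : ((n : ℂ) + 1) * coeff (n + 1) f = coeff n a + coeff n (q * invSqrtSeries 1) := by
    rw [← map_add, ← hf, coeff_derivative, mul_comm]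
  have h2 := hq.norm_coeff_mul_invSqrtSeries_sub_le n
  have h3 : ‖evalOne q * ((invSqrtCoeff n - (√(Real.pi * n))⁻¹ : ℝ) : ℂ)‖ ≤
      4 * L * (n : ℝ)⁻¹ := by
    rw [norm_mul, Complex.norm_real, Real.norm_eq_abs]
    exact mul_le_mul hq.hasL1Bound.norm_evalOne_le (abs_invSqrtCoeff_sub_le hn) (abs_nonneg _)
      (by positivity)
  have hinv : ((n : ℝ) + 1)⁻¹ ≤ (n : ℝ)⁻¹ := by gcongr; linarith
  have h4 : ‖coeff n a‖ ≤ K * (n : ℝ)⁻¹ := by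
    refine (ha n).trans (mul_le_mul_of_nonneg_left (le_trans ?_ hinv) hK)
    rw [decayWeight_eq]
    refine mul_le_of_le_one_right (by positivity) (inv_le_one_of_one_le₀ (Real.one_le_sqrt.2 ?_))
    linarith
  have h5 : 20 * L * ((n : ℝ) + 1)⁻¹ ≤ 20 * L * (n : ℝ)⁻¹ := by gcongr
  have e : ((n : ℂ) + 1) * coeff (n + 1) f - evalOne q * ((√(Real.pi * n))⁻¹ : ℝ) =
      coeff n a + (coeff n (q * invSqrtSeries 1) - evalOne q * invSqrtCoeff n) +
        evalOne q * ((invSqrtCoeff n - (√(Real.pi * n))⁻¹ : ℝ) : ℂ) := by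
    rw [h1]
    push_cast
    ring
  rw [e]
  calc _ ≤ _ := norm_add₃_le
    _ ≤ _ := by linarith

end PowerSeries

/-! ### Functions positive at `u = 1`, which settle the branches of square roots nearby. -/

section positive

/-- The function is continuous at `1`, with a positive real value there. -/
def PosAtOne (f : ℂ → ℂ) : Prop := ContinuousAt f 1 ∧ ∃ r : ℝ, 0 < r ∧ f 1 = r

namespace PosAtOne

variable {f g : ℂ → ℂ}

theorem const {r : ℝ} (hr : 0 < r) : PosAtOne fun _ => (r : ℂ) :=
  ⟨continuousAt_const, r, hr, rfl⟩

theorem id : PosAtOne fun u => u := ⟨continuousAt_id, 1, one_pos, by simp⟩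

theorem natCast {n : ℕ} (hn : 0 < n) : PosAtOne fun _ => (n : ℂ) := by
  simpa using const (r := n) (by exact_mod_cast hn)

theorem one : PosAtOne fun _ => 1 := by simpa using const one_pos

theorem add (hf : PosAtOne f) (hg : PosAtOne g) : PosAtOne fun u => f u + g u := by
  obtain ⟨hf, r, hr, hfr⟩ := hf
  obtain ⟨hg, t, ht, hgt⟩ := hg
  exact ⟨hf.add hg, r + t, add_pos hr ht, by simp [hfr, hgt]⟩

theorem mul (hf : PosAtOne f) (hg : PosAtOne g) : PosAtOne fun u => f u * g u := by
  obtain ⟨hf, r, hr, hfr⟩ := hf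
  obtain ⟨hg, t, ht, hgt⟩ := hg
  exact ⟨hf.mul hg, r * t, mul_pos hr ht, by simp [hfr, hgt]⟩

theorem inv (hf : PosAtOne f) : PosAtOne fun u => (f u)⁻¹ := by
  obtain ⟨hf, r, hr, hfr⟩ := hf
  refine ⟨hf.inv₀ ?_, r⁻¹, inv_pos.2 hr, by simp [hfr]⟩
  rw [hfr]
  exact_mod_cast hr.ne'

theorem div (hf : PosAtOne f) (hg : PosAtOne g) : PosAtOne fun u => f u / g u := by
  simpa only [div_eq_mul_inv] using hf.mul hg.inv

theorem sqrt (hf : PosAtOne f) : PosAtOne fun u => Complex.sqrt (f u) := by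
  obtain ⟨hf, r, hr, hfr⟩ := hf
  refine ⟨ContinuousAt.comp (g := Complex.sqrt) (Complex.continuousAt_sqrt (Or.inl ?_)) hf,
    √r, Real.sqrt_pos.2 hr, ?_⟩
  · rw [hfr]
    exact hr.le
  · simp only [hfr]
    rw [Complex.sqrt_of_nonneg (Complex.zero_le_real.2 hr.le), Complex.ofReal_re]

theorem prod {ι : Type*} {s : Finset ι} {F : ι → ℂ → ℂ} (h : ∀ i ∈ s, PosAtOne (F i)) :
    PosAtOne fun u => ∏ i ∈ s, F i u := by
  classical
  induction s using Finset.induction_on with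
  | empty => simpa using one
  | insert a s ha ih =>
    simp only [Finset.prod_insert ha]
    exact (h a (Finset.mem_insert_self a s)).mul
      (ih fun i hi => h i (Finset.mem_insert_of_mem hi))

theorem eventually_re_pos (hf : PosAtOne f) : ∀ᶠ u in 𝓝 1, 0 < (f u).re := by
  obtain ⟨hf, r, hr, hfr⟩ := hf
  refine (Complex.continuous_re.continuousAt.comp hf).eventually (lt_mem_nhds ?_)
  simpa [hfr] using hr

theorem eventually_ne_zero (hf : PosAtOne f) : ∀ᶠ u in 𝓝 1, f u ≠ 0 := by
  filter_upwards [hf.eventually_re_pos] with u hu h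
  simp [h] at hu

end PosAtOne

theorem Complex.sqrt_sq (z : ℂ) : Complex.sqrt z ^ 2 = z := by
  simp [Complex.sqrt]

theorem Complex.eq_of_sq_eq_sq_of_re_pos {a b : ℂ} (h : a ^ 2 = b ^ 2) (ha : 0 < a.re)
    (hb : 0 < b.re) : a = b := by
  rcases sq_eq_sq_iff_eq_or_eq_neg.1 h with h | h
  · exact h
  · rw [h, Complex.neg_re] at ha
    linarith

end positive

/-! ### Convergence and positivity of coefficients. -/

namespace PowerSeries

open ComplexOrder

theorem tendsto_coeff_mul {ι : Type*} {l : Filter ι} {f g : ι → ℂ⟦X⟧} {f₀ g₀ : ℂ⟦X⟧}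
    (hf : ∀ n, Tendsto (fun u => coeff n (f u)) l (𝓝 (coeff n f₀)))
    (hg : ∀ n, Tendsto (fun u => coeff n (g u)) l (𝓝 (coeff n g₀))) (n : ℕ) :
    Tendsto (fun u => coeff n (f u * g u)) l (𝓝 (coeff n (f₀ * g₀))) := by
  simp only [coeff_mul]
  exact tendsto_finsetSum _ fun ab _ => (hf ab.1).mul (hg ab.2)

theorem tendsto_coeff_C {ι : Type*} {l : Filter ι} {a : ι → ℂ} {a₀ : ℂ}
    (h : Tendsto a l (𝓝 a₀)) (n : ℕ) :
    Tendsto (fun u => coeff n (C (a u))) l (𝓝 (coeff n (C a₀))) := by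
  simp only [coeff_C]
  split_ifs
  · exact h
  · exact tendsto_const_nhds

theorem coeff_mul_nonneg {f g : ℂ⟦X⟧} (hf : ∀ n, 0 ≤ coeff n f) (hg : ∀ n, 0 ≤ coeff n g)
    (n : ℕ) : 0 ≤ coeff n (f * g) := by
  rw [coeff_mul]
  exact Finset.sum_nonneg fun ab _ => mul_nonneg (hf _) (hg _)

theorem coeff_C_nonneg {a : ℂ} (ha : 0 ≤ a) (n : ℕ) : 0 ≤ coeff n (C a) := by
  rw [coeff_C]
  split_ifs
  · exact ha
  · exact le_rfl

theorem coeff_X_nonneg (n : ℕ) : 0 ≤ coeff n (X : ℂ⟦X⟧) := by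
  rw [coeff_X]
  split_ifs
  · exact zero_le_one
  · exact le_rfl

/-- This reduces the subcriticality of `y_i` at `u = 1` to its value at the singularity. -/
theorem tsum_norm_coeff_eq_re {f : ℂ⟦X⟧} (hf : ∀ n, 0 ≤ coeff n f) :
    ∑' n, ‖coeff n f‖ = (evalOne f).re := by
  have h : evalOne f = ((∑' n, ‖coeff n f‖ : ℝ) : ℂ) := by
    rw [Complex.ofReal_tsum]
    exact tsum_congr fun n => Complex.eq_coe_norm_of_nonneg (hf n)
  rw [h, Complex.ofReal_re]

theorem eq_of_sq_eq_sq_of_constantCoeff_eq_one {f g : ℂ⟦X⟧} (h : f ^ 2 = g ^ 2)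
    (hf : constantCoeff f = 1) (hg : constantCoeff g = 1) : f = g := by
  rcases sq_eq_sq_iff_eq_or_eq_neg.1 h with h | h
  · exact h
  · have := congrArg constantCoeff h
    rw [map_neg, hf, hg] at this
    norm_num at this

end PowerSeries

/-! ### The rescaled quadratic system and its solution at level `k`. -/

namespace LambdaTerm

open PowerSeries ComplexOrder

/-- The generating function of terms closed under `i` abstractions, with `z = r x`. -/
noncomputable def openSeries (k : ℕ) (u r : ℂ) (i : ℕ) : ℂ⟦X⟧ :=
  mk fun n => r ^ n * openPoly k u i n

theorem openSeries_eq (k : ℕ) (u r : ℂ) (i : ℕ) :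
    openSeries k u r i = C ((min i k : ℕ) * u * r) * X + C r * (X * openSeries k u r (i + 1)) +
      C r * (X * openSeries k u r i ^ 2) := by
  ext n
  simp only [map_add, coeff_C_mul, sq]
  cases n with
  | zero => simp [openSeries, openPoly_size_zero]
  | succ n =>
    rw [coeff_succ_X_mul, coeff_succ_X_mul, coeff_mul, coeff_X]
    simp only [openSeries, coeff_mk]
    rw [openPoly_size_succ, mul_add, mul_add, Finset.mul_sum, Finset.mul_sum]
    congr 1
    · congr 1
      · rcases eq_or_ne n 0 with rfl | h
        · simp
          ring
        · simp [h]
      · ring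
    · refine Finset.sum_congr rfl fun ab hab => ?_
      rw [← Finset.HasAntidiagonal.mem_antidiagonal.1 hab]
      ring

/-- The dominant singularity `1 / (1 + 2 √(k u))`. -/
noncomputable def radius (k : ℕ) (u : ℂ) : ℂ := (1 + 2 * Complex.sqrt (k * u))⁻¹

/-- The ratio of the dominant singularity to the conjugate one. -/
noncomputable def conjRatio (k : ℕ) (u : ℂ) : ℂ := (1 - 2 * Complex.sqrt (k * u)) * radius k u

/-- `2 z P(z)` at `z = radius * x`, for `P` the generating function of terms closed under `i`
abstractions. -/
noncomputable def scaledSeries (k i : ℕ) (u : ℂ) : ℂ⟦X⟧ :=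
  C (2 * radius k u) * (X * openSeries k u (radius k u) i)

variable {k : ℕ}

theorem constantCoeff_scaledSeries (i : ℕ) (u : ℂ) : constantCoeff (scaledSeries k i u) = 0 := by
  simp [scaledSeries]

theorem coeff_succ_scaledSeries (i n : ℕ) (u : ℂ) :
    coeff (n + 1) (scaledSeries k i u) = 2 * radius k u ^ (n + 1) * openPoly k u i n := by
  rw [scaledSeries, coeff_C_mul, coeff_succ_X_mul, openSeries, coeff_mk]
  ring

theorem two_mul_scaledSeries (i : ℕ) (u : ℂ) :
    2 * scaledSeries k i u = C (4 * (min i k : ℕ) * u * radius k u ^ 2) * X ^ 2 +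
      C (2 * radius k u) * (X * scaledSeries k (i + 1) u) + scaledSeries k i u ^ 2 := by
  have h := openSeries_eq k u (radius k u) i
  have h2 : C (2 : ℂ) = (2 : ℂ⟦X⟧) := map_ofNat C 2
  have h4 : C (4 : ℂ) = (4 : ℂ⟦X⟧) := map_ofNat C 4
  simp only [scaledSeries, map_mul, map_pow, h2, h4] at h ⊢
  linear_combination 4 * C (radius k u) * X * h

theorem scaledSeries_succ_self (u : ℂ) : scaledSeries k (k + 1) u = scaledSeries k k u := by
  simp only [scaledSeries, openSeries, openPoly_succ_of_le le_rfl]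

theorem posAtOne_sqrt_mul (hk : 0 < k) : PosAtOne fun u => Complex.sqrt (k * u) :=
  ((PosAtOne.natCast hk).mul .id).sqrt

theorem posAtOne_two : PosAtOne fun _ => 2 := by simpa using PosAtOne.natCast (n := 2) two_pos

theorem posAtOne_radius (hk : 0 < k) : PosAtOne (radius k) :=
  (PosAtOne.one.add (posAtOne_two.mul (posAtOne_sqrt_mul hk))).inv

theorem posAtOne_c (m : ℕ) : PosAtOne fun u => c u (m + 1) := by
  induction m with
  | zero => simpa [c] using PosAtOne.one
  | succ m ih =>
    have h : PosAtOne fun u => 4 * ((m : ℂ) + 1) * u - 1 := by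
      refine ⟨by fun_prop, 4 * (m + 1) - 1, ?_, by simp⟩
      linarith [m.cast_nonneg (α := ℝ)]
    exact h.add (posAtOne_two.mul ih.sqrt)

theorem eventually_radius_mul (hk : 0 < k) :
    ∀ᶠ u in 𝓝 1, radius k u * (1 + 2 * Complex.sqrt (k * u)) = 1 := by
  filter_upwards [(posAtOne_radius hk).eventually_ne_zero] with u hu
  exact inv_mul_cancel₀ fun h => hu (by rw [radius, h, inv_zero])

theorem eventually_norm_conjRatio_le (hk : 0 < k) :
    ∃ β < 1, ∀ᶠ u in 𝓝 1, ‖conjRatio k u‖ ≤ β := by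
  have hc : ContinuousAt (fun u => ‖conjRatio k u‖) 1 :=
    ((continuousAt_const.sub (continuousAt_const.mul (posAtOne_sqrt_mul hk).1)).mul
      (posAtOne_radius hk).1).norm
  have h1 : ‖conjRatio k 1‖ < 1 := by
    obtain ⟨-, r, hr, h⟩ := posAtOne_sqrt_mul hk
    have e : conjRatio k 1 = (((1 - 2 * r) / (1 + 2 * r) : ℝ) : ℂ) := by
      rw [conjRatio, radius]
      simp only at h
      rw [h]
      push_cast
      rw [div_eq_mul_inv]
    rw [e, Complex.norm_real, Real.norm_eq_abs, abs_div, abs_of_pos (by linarith : 0 < 1 + 2 * r),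
      div_lt_one (by linarith), abs_lt]
    constructor <;> linarith
  obtain ⟨β, hβ, hβ1⟩ := exists_between h1
  exact ⟨β, hβ1, (hc.eventually (gt_mem_nhds hβ)).mono fun u hu => le_of_lt hu⟩

/-- Since level `k + 1` equals level `k`, completing the square gives `(1 - ρ x - x_k)² = (1 - ρ x)²
- 4 k u ρ² x² = (1 - x)(1 - b x)`; the constant term 1 selects the root. -/
theorem eventually_scaledSeries_self (hk : 0 < k) : ∀ᶠ u in 𝓝 1, scaledSeries k k u =
    1 - C (radius k u) * X - sqrtSeries 1 * sqrtSeries (conjRatio k u) := by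
  filter_upwards [eventually_radius_mul hk] with u hu
  have h := two_mul_scaledSeries (k := k) k u
  rw [scaledSeries_succ_self, min_self] at h
  have hs := Complex.sqrt_sq (k * u)
  have h2 : C (2 : ℂ) = (2 : ℂ⟦X⟧) := map_ofNat C 2
  have hb : conjRatio k u = 2 * radius k u - 1 := by
    rw [conjRatio]
    linear_combination -hu
  -- By definition of the radius, `2 ρ √(ku) = 1 - ρ`.
  have hku : 4 * k * u * radius k u ^ 2 = (1 - radius k u) ^ 2 := by
    linear_combination (-(4 * radius k u ^ 2)) * hs +
      (1 - radius k u + 2 * radius k u * Complex.sqrt (k * u)) * hu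
  have key : 1 - C (radius k u) * X - scaledSeries k k u =
      sqrtSeries 1 * sqrtSeries (conjRatio k u) := by
    refine eq_of_sq_eq_sq_of_constantCoeff_eq_one ?_ ?_ ?_
    · rw [mul_pow, sqrtSeries_sq, sqrtSeries_sq, hb]
      rw [hku] at h
      simp only [map_mul, map_pow, map_sub, map_one, h2] at h ⊢
      linear_combination -h
    · simp [constantCoeff_scaledSeries]
    · rw [map_mul, ← coeff_zero_eq_constantCoeff_apply, ← coeff_zero_eq_constantCoeff_apply,
        coeff_zero_sqrtSeries, coeff_zero_sqrtSeries, one_mul]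
  linear_combination -key

theorem tendsto_coeff_scaledSeries (hk : 0 < k) (i n : ℕ) :
    Tendsto (fun u => coeff n (scaledSeries k i u)) (𝓝 1) (𝓝 (coeff n (scaledSeries k i 1))) := by
  cases n with
  | zero => simp [constantCoeff_scaledSeries]
  | succ n =>
    simp only [coeff_succ_scaledSeries]
    exact (tendsto_const_nhds.mul ((posAtOne_radius hk).1.pow (n + 1))).mul
      (continuous_openPoly k i n).continuousAt

theorem coeff_scaledSeries_one_nonneg (hk : 0 < k) (i n : ℕ) :
    0 ≤ coeff n (scaledSeries k i 1) := by
  cases n with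
  | zero => simp [constantCoeff_scaledSeries]
  | succ n =>
    rw [coeff_succ_scaledSeries]
    obtain ⟨-, r, hr, h⟩ := posAtOne_radius hk
    obtain ⟨p, hp, hp'⟩ := openPoly_one_nonneg k i n
    rw [h, hp']
    exact_mod_cast (by positivity : 0 ≤ 2 * r ^ (n + 1) * p)

end LambdaTerm

/-! ### Propagation of the singularity from level `k` to level `0`. -/

namespace LambdaTerm

open PowerSeries ComplexOrder

variable {k : ℕ}

/-- The value at `1` and the singular behaviour of `scaledSeries k i`, uniformly near `u = 1`, in
terms of `c 1, …, c (m + 1)`. -/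
structure SingularBehaviour (k m i : ℕ) : Prop where
  decay : UnifDecay (𝓝 1) (scaledSeries k i)
  evalOne_eq : ∀ᶠ u in 𝓝 1,
    evalOne (scaledSeries k i u) = 1 - radius k u * Complex.sqrt (c u (m + 1))
  derivative_eq : ∃ a q : ℂ → ℂ⟦X⟧, UnifDecay (𝓝 1) a ∧ UnifDecay (𝓝 1) q ∧ ∀ᶠ u in 𝓝 1,
    d⁄dX ℂ (scaledSeries k i u) = a u + q u * invSqrtSeries 1 ∧
      evalOne (q u) = evalOne (sqrtSeries (conjRatio k u)) / 2 *
        ∏ l ∈ Finset.Icc 2 (m + 1), (Complex.sqrt (c u l))⁻¹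

theorem unifDecay_radius (hk : 0 < k) : UnifDecay (𝓝 1) fun u => C (radius k u) :=
  unifDecay_C (posAtOne_radius hk).1

/-- In the product rule only the derivative of `√(1 - x)` is singular, so `q` is half of `√(1 - b
x)`. At `x = 1` the radical vanishes, leaving `1 - ρ = 1 - ρ √c_1`. -/
theorem singularBehaviour_self (hk : 0 < k) : SingularBehaviour k 0 k := by
  obtain ⟨β, hβ, hb⟩ := eventually_norm_conjRatio_le hk
  have hx := eventually_scaledSeries_self hk
  have hS : UnifDecay (𝓝 (1 : ℂ)) fun _ => sqrtSeries 1 :=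
    ⟨2, .of_forall fun _ => hasDecay_sqrtSeries (by simp)⟩
  have hB : UnifDecay (𝓝 1) fun u => sqrtSeries (conjRatio k u) :=
    ⟨2, hb.mono fun u hu => hasDecay_sqrtSeries (hu.trans hβ.le)⟩
  have hJ : UnifDecay (𝓝 1) fun u => invSqrtSeries (conjRatio k u) :=
    ⟨(1 - β)⁻¹, hb.mono fun u hu => hasDecay_invSqrtSeries hu hβ⟩
  have hbc : Tendsto (fun u => -(conjRatio k u / 2)) (𝓝 1) (𝓝 (-(conjRatio k 1 / 2))) :=
    ((((continuousAt_const.sub (continuousAt_const.mul (posAtOne_sqrt_mul hk).1)).mul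
      (posAtOne_radius hk).1).div_const 2).neg : ContinuousAt (fun u => -(conjRatio k u / 2)) 1)
  have hhalf : UnifDecay (𝓝 (1 : ℂ)) fun _ => C (1 / 2 : ℂ) := unifDecay_C tendsto_const_nhds
  have hlin := (unifDecay_one.sub ((unifDecay_radius hk).mul unifDecay_X))
  have hR : UnifDecay (𝓝 1) fun u => C (-radius k u) := unifDecay_C (posAtOne_radius hk).1.neg
  refine ⟨?_, ?_, _, _,
    hR.sub (hS.mul ((unifDecay_C hbc).mul hJ)), hhalf.mul hB, ?_⟩
  · obtain ⟨K, hK⟩ := hlin.sub (hS.mul hB)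
    exact ⟨K, by filter_upwards [hK, hx] with u h1 h2 using h2 ▸ h1⟩
  · filter_upwards [hx, hb] with u h1 h2
    have dS : HasDecay 2 (sqrtSeries 1) := hasDecay_sqrtSeries (by simp)
    have dB := hasDecay_sqrtSeries (h2.trans hβ.le)
    have dR := (hasDecay_C (radius k u)).mul hasDecay_X
    have d1 : HasDecay ‖(1 : ℂ)‖ 1 := by simpa using hasDecay_C 1
    have hS0 : evalOne (sqrtSeries 1) = 0 := by
      simpa using evalOne_sqrtSeries_sq (b := 1) (by simp)
    rw [h1, (d1.sub dR).evalOne_sub (dS.mul dB), d1.evalOne_sub dR, dS.evalOne_mul dB,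
      (hasDecay_C _).evalOne_mul hasDecay_X, hS0, evalOne_one, evalOne_C, evalOne_X]
    simp [c]
  · filter_upwards [hx, hb] with u h1 h2
    have dB := hasDecay_sqrtSeries (h2.trans hβ.le)
    constructor
    · rw [h1, map_sub, map_sub, derivative_one, Derivation.leibniz, Derivation.leibniz,
        derivative_C, derivative_X, derivative_sqrtSeries, derivative_sqrtSeries]
      simp only [smul_eq_mul, map_neg]
      ring
    · rw [(hasDecay_C _).evalOne_mul dB, evalOne_C]
      simp
      ring

/-- From `x_i' = (1 - x_i)⁻¹ y' / 2` the singular factor becomes `ρ x (1 - x_i)⁻¹ q`. At `x = 1` the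
new factor is `ρ / (1 - x_i(1)) = 1 / √c_{m+2}`. -/
theorem SingularBehaviour.step (hk : 0 < k) {m i : ℕ} (him : i + 1 + m = k)
    (h : SingularBehaviour k m (i + 1)) : SingularBehaviour k (m + 1) i := by
  obtain ⟨hdec, heval, a, q, ha, hq, haq⟩ := h
  have hρ := posAtOne_radius hk
  have hconst : ContinuousAt (fun u => 4 * (i : ℂ) * u * radius k u ^ 2) 1 :=
    (continuousAt_const.mul continuousAt_id).mul (hρ.1.pow 2)
  have hconst2 : ContinuousAt (fun u => 2 * radius k u) 1 := continuousAt_const.mul hρ.1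
  set y : ℂ → ℂ⟦X⟧ := fun u => C (4 * (i : ℂ) * u * radius k u ^ 2) * X ^ 2 +
    C (2 * radius k u) * (X * scaledSeries k (i + 1) u) with hy_def
  have hquad : ∀ u, 2 * scaledSeries k i u = y u + scaledSeries k i u ^ 2 := fun u => by
    have := two_mul_scaledSeries (k := k) i u
    rwa [min_eq_left (by omega)] at this
  have hX2 : UnifDecay (𝓝 (1 : ℂ)) fun _ => (X : ℂ⟦X⟧) ^ 2 := by
    simpa only [sq] using unifDecay_X.mul unifDecay_X
  have hy : UnifDecay (𝓝 1) y :=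
    ((unifDecay_C hconst).mul hX2).add ((unifDecay_C hconst2).mul (unifDecay_X.mul hdec))
  have hytend : ∀ n, Tendsto (fun u => coeff n (y u)) (𝓝 1) (𝓝 (coeff n (y 1))) := fun n => by
    simp only [hy_def, map_add]
    exact (tendsto_coeff_mul (tendsto_coeff_C hconst) (fun _ => tendsto_const_nhds) n).add
      (tendsto_coeff_mul (tendsto_coeff_C hconst2) (tendsto_coeff_mul
        (fun _ => tendsto_const_nhds) (tendsto_coeff_scaledSeries hk (i + 1))) n)
  have hyeval : ∀ᶠ u in 𝓝 1, evalOne (y u) = 1 - radius k u ^ 2 * c u (m + 2) := by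
    obtain ⟨K, hK⟩ := hdec
    filter_upwards [hK, heval, eventually_radius_mul hk] with u h1 h2 h3
    have hs := Complex.sqrt_sq (k * u)
    have dX2 := hasDecay_X.mul hasDecay_X
    rw [← sq] at dX2
    have e2 : evalOne (X ^ 2) = 1 := by
      rw [sq, hasDecay_X.evalOne_mul hasDecay_X, evalOne_X, one_mul]
    simp only [hy_def]
    rw [((hasDecay_C _).mul dX2).evalOne_add ((hasDecay_C _).mul (hasDecay_X.mul h1)),
      (hasDecay_C _).evalOne_mul dX2, (hasDecay_C _).evalOne_mul (hasDecay_X.mul h1),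
      hasDecay_X.evalOne_mul h1, e2, evalOne_X, evalOne_C, evalOne_C, h2, c]
    -- With `4 k u ρ² = (1 - ρ)²`, the value `4 i u ρ² + 2 ρ (1 - ρ √c_{m+1})` collapses to `1 - ρ²
    -- c_{m+2}`: this is where the recursion for `c` comes from.
    have hki : (i : ℂ) = k - 1 - m := by
      rw [← him]
      push_cast
      ring
    rw [hki]
    linear_combination (-(4 * radius k u ^ 2)) * hs +
      (1 - radius k u + 2 * radius k u * Complex.sqrt (k * u)) * h3
  have hnonneg : ∀ n, 0 ≤ coeff n (y 1) := fun n => by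
    simp only [hy_def, map_add, sq]
    obtain ⟨-, r, hr, hr'⟩ := hρ
    refine add_nonneg (coeff_mul_nonneg (coeff_C_nonneg ?_)
      (coeff_mul_nonneg coeff_X_nonneg coeff_X_nonneg) n)
      (coeff_mul_nonneg (coeff_C_nonneg ?_)
      (coeff_mul_nonneg coeff_X_nonneg (coeff_scaledSeries_one_nonneg hk (i + 1))) n)
    · rw [hr']
      exact_mod_cast (by positivity : 0 ≤ 4 * (i : ℝ) * 1 * (r * r))
    · rw [hr']
      exact_mod_cast (by positivity : 0 ≤ 2 * r)
  have hc := posAtOne_c (m + 1)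
  have hsmall : ∑' n, ‖coeff n (y 1)‖ < 1 := by
    rw [tsum_norm_coeff_eq_re hnonneg, hyeval.self_of_nhds]
    have := ((hρ.mul hρ).mul hc).eventually_re_pos.self_of_nhds
    rw [← sq] at this
    rw [Complex.sub_re, Complex.one_re]
    linarith
  obtain ⟨θ, hθ, hyθ⟩ := hy.eventually_hasL1Bound hytend hsmall
  obtain ⟨hv, hx, hx1⟩ := hy.of_quadratic hθ hyθ (constantCoeff_scaledSeries i) (.of_forall hquad)
  have hxeval : ∀ᶠ u in 𝓝 1,
      evalOne (scaledSeries k i u) = 1 - radius k u * Complex.sqrt (c u (m + 2)) := by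
    obtain ⟨K, hK⟩ := hx
    obtain ⟨L, hL⟩ := hy
    filter_upwards [hK, hL, hx1, hyeval, (hρ.mul hc.sqrt).eventually_re_pos] with u h1 h2 h3 h4 h5
    have e1 : 2 * evalOne (scaledSeries k i u) =
        evalOne (y u) + evalOne (scaledSeries k i u) ^ 2 := by
      have := congrArg evalOne (hquad u)
      rwa [← map_ofNat C 2, (hasDecay_C _).evalOne_mul h1, evalOne_C, sq,
        h2.evalOne_add (h1.mul h1), h1.evalOne_mul h1, ← sq] at this
    -- The norm bound `1 - √(1 - θ) < 1` on `x_i(1)` forces the principal branch.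
    have hre : 0 < (1 - evalOne (scaledSeries k i u)).re := by
      have h6 := (Complex.abs_re_le_norm _).trans h3.norm_evalOne_le
      have h7 : 0 < √(1 - θ) := Real.sqrt_pos.2 (by linarith)
      rw [Complex.sub_re, Complex.one_re]
      linarith [(abs_le.1 h6).2]
    have e2 : 1 - evalOne (scaledSeries k i u) = radius k u * Complex.sqrt (c u (m + 2)) := by
      refine Complex.eq_of_sq_eq_sq_of_re_pos ?_ hre h5
      rw [mul_pow, Complex.sqrt_sq]
      linear_combination -e1 - h4
    linear_combination -e2
  have hhalf : UnifDecay (𝓝 (1 : ℂ)) fun _ => C (1 / 2 : ℂ) := unifDecay_C tendsto_const_nhds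
  refine ⟨hx, hxeval, _, _, hhalf.mul (hv.mul ((((unifDecay_C hconst).mul
    (unifDecay_C (tendsto_const_nhds (x := (2 : ℂ))))).mul unifDecay_X).add
      ((unifDecay_C hconst2).mul (hdec.add (unifDecay_X.mul ha))))),
    (unifDecay_radius hk).mul (unifDecay_X.mul (hv.mul hq)), ?_⟩
  obtain ⟨K, hK⟩ := hx
  obtain ⟨L, hL⟩ := hv
  obtain ⟨D, hD⟩ := hq
  filter_upwards [hK, hL, hD, haq, hxeval, hρ.eventually_ne_zero] with u h1 h2 h3 h4 h5 h6
  constructor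
  · rw [(derivative_inv_one_sub_of_quadratic (constantCoeff_scaledSeries i u) (hquad u)).1]
    have hhalf' : C (1 / 2 : ℂ) * 2 = (1 : ℂ⟦X⟧) := by
      rw [← map_ofNat C 2, ← map_mul]; norm_num
    have hdy : d⁄dX ℂ (y u) = C (4 * (i : ℂ) * u * radius k u ^ 2) * C 2 * X +
        C (2 * radius k u) * (scaledSeries k (i + 1) u + X * (a u + q u * invSqrtSeries 1)) := by
      simp only [hy_def]
      rw [map_add, Derivation.leibniz, Derivation.leibniz, Derivation.leibniz, derivative_C,
        derivative_C, derivative_X, derivative_pow, derivative_X, h4.1]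
      simp only [smul_eq_mul, map_ofNat]
      push_cast
      ring
    have h2C : C (2 * radius k u) = 2 * C (radius k u) := by
      rw [map_mul, map_ofNat]
    rw [hdy]
    linear_combination
      (C (1 / 2 : ℂ) * (1 - scaledSeries k i u)⁻¹ * X * q u * invSqrtSeries 1) * h2C +
      (C (radius k u) * X * (1 - scaledSeries k i u)⁻¹ * q u * invSqrtSeries 1) * hhalf'
  · have hinv : (1 - evalOne (scaledSeries k i u)) * evalOne (1 - scaledSeries k i u)⁻¹ = 1 := by
      have d1 : HasDecay ‖(1 : ℂ)‖ 1 := by simpa using hasDecay_C 1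
      rw [← evalOne_one, ← d1.evalOne_sub h1, ← (d1.sub h1).evalOne_mul h2,
        PowerSeries.mul_inv_cancel _ (by simp [constantCoeff_scaledSeries])]
    rw [h5, sub_sub_cancel] at hinv
    have hc0 : Complex.sqrt (c u (m + 2)) ≠ 0 := fun h0 => by simp [h0] at hinv
    have hv1 : radius k u * evalOne (1 - scaledSeries k i u)⁻¹ =
        (Complex.sqrt (c u (m + 2)))⁻¹ := by
      field_simp
      linear_combination hinv
    rw [(hasDecay_C _).evalOne_mul (hasDecay_X.mul (h2.mul h3)), hasDecay_X.evalOne_mul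
      (h2.mul h3), h2.evalOne_mul h3, evalOne_C, evalOne_X, h4.2,
      Finset.prod_Icc_succ_top (by omega : 2 ≤ m + 1 + 1), ← hv1]
    ring

theorem singularBehaviour (hk : 0 < k) {m i : ℕ} (h : i + m = k) : SingularBehaviour k m i := by
  induction m generalizing i with
  | zero =>
    obtain rfl : i = k := h
    exact singularBehaviour_self hk
  | succ m ih => exact (ih (i := i + 1) (by omega)).step hk (by omega)

end LambdaTerm

/-! ### Extraction of the asymptotics. -/

namespace LambdaTerm

open PowerSeries

variable {k : ℕ}

/-- The relative error of `p ≈ l R ^ n n ^ (-3 / 2)`, where `r = 1 / R` and `l = q / (2 r √π)`,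
given an approximation of `2 (n + 1) r ^ (n + 1) p` by `q / √(π n)`. -/
theorem norm_div_sub_one_le {p q r l : ℂ} {K μ : ℝ} {n : ℕ} (hn : 0 < n) (hμ : 0 < μ)
    (hq : μ ≤ ‖q‖) (hl : l = q / (2 * r * (√Real.pi : ℝ)))
    (h : ‖((n : ℂ) + 1) * (2 * r ^ (n + 1) * p) - q * ((√(Real.pi * n))⁻¹ : ℝ)‖ ≤ K * (n : ℝ)⁻¹) :
    ‖p / (l * r⁻¹ ^ n * (((n : ℝ) ^ (-(3 / 2) : ℝ) : ℝ) : ℂ)) - 1‖ ≤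
      (K * √Real.pi / μ + 1) / √(n : ℝ) := by
  have hn1 : (1 : ℝ) ≤ n := by exact_mod_cast hn
  have hn0 : (0 : ℝ) < n := by linarith
  have hw : (n : ℝ) ^ (-(3 / 2) : ℝ) = (n * √(n : ℝ))⁻¹ := by
    rw [Real.rpow_neg hn0.le, show (3 / 2 : ℝ) = 1 + 1 / 2 by norm_num, Real.rpow_add hn0,
      Real.rpow_one, ← Real.sqrt_eq_rpow]
  have hq0 : q ≠ 0 := norm_pos_iff.1 (hμ.trans_le hq)
  have hK : 0 ≤ K := by
    have := (norm_nonneg _).trans h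
    exact nonneg_of_mul_nonneg_left this (by positivity)
  have ht2 : √(n : ℝ) * √(n : ℝ) = n := Real.mul_self_sqrt hn0.le
  have ht0 : 0 < √(n : ℝ) := Real.sqrt_pos.2 hn0
  have ht1 : √(n : ℝ) ≤ n := by
    rw [Real.sqrt_le_iff]
    exact ⟨hn0.le, by nlinarith⟩
  have hp0 : 0 < √Real.pi := Real.sqrt_pos.2 Real.pi_pos
  rw [Real.sqrt_mul Real.pi_pos.le] at h
  rw [hw, hl]
  have ht2' : ((√(n : ℝ) : ℝ) : ℂ) * ((√(n : ℝ) : ℝ) : ℂ) = n := by exact_mod_cast ht2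
  have ht0' : ((√(n : ℝ) : ℝ) : ℂ) ≠ 0 := by exact_mod_cast ht0.ne'
  have hp0' : ((√Real.pi : ℝ) : ℂ) ≠ 0 := by exact_mod_cast hp0.ne'
  have hn0' : (n : ℂ) ≠ 0 := by exact_mod_cast hn.ne'
  have hn1' : (n : ℂ) + 1 ≠ 0 := by exact_mod_cast n.succ_ne_zero
  generalize √Real.pi = s at *
  generalize √(n : ℝ) = t at *
  set d := ((n : ℂ) + 1) * (2 * r ^ (n + 1) * p) - q * ((s * t)⁻¹ : ℝ) with hd
  -- The term `1 / (n + 1)` is the cost of replacing `n + 1` by `n`; the other one is the given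
  -- error, divided by the main term.
  have e : p / (q / (2 * r * s) * r⁻¹ ^ n * (((n * t)⁻¹ : ℝ) : ℂ)) - 1 =
      d * (s * t) / q * (n / (n + 1)) - 1 / (n + 1) := by
    rw [hd, inv_pow]
    push_cast
    field_simp
    ring
  have hnn : ‖(n : ℂ) + 1‖ = (n : ℝ) + 1 := by exact_mod_cast Complex.norm_natCast (n + 1)
  have h1 : ‖d * (s * t) / q * (n / (n + 1))‖ ≤ K * s / μ / t := by
    rw [norm_mul, norm_div, norm_div, norm_mul, norm_mul, Complex.norm_real, Complex.norm_real,
      Complex.norm_natCast, hnn, Real.norm_of_nonneg hp0.le, Real.norm_of_nonneg ht0.le]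
    calc _ ≤ K * (n : ℝ)⁻¹ * (s * t) / μ * 1 := by
          refine mul_le_mul (by gcongr) ?_ (by positivity) (by positivity)
          rw [div_le_one (by positivity)]
          linarith
      _ = _ := by
          rw [← ht2]
          field_simp
  have h2 : ‖1 / ((n : ℂ) + 1)‖ ≤ 1 / t := by
    rw [norm_div, norm_one, hnn]
    gcongr
    linarith
  rw [e, add_div]
  exact (norm_sub_le _ _).trans (add_le_add h1 h2)

/-- The value at `1` of the factor of `(1 - x) ^ (-1 / 2)` in the derivative of the scaled
generating function of closed terms. -/
noncomputable def singularFactor (k : ℕ) (u : ℂ) : ℂ :=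
  Complex.sqrt (4 * (Complex.sqrt (k * u) * radius k u)) / 2 *
    ∏ l ∈ Finset.Icc 2 (k + 1), (Complex.sqrt (c u l))⁻¹

/-- The constant factor in the asymptotics of the number of closed terms. -/
noncomputable def leadingConstant (k : ℕ) (u : ℂ) : ℂ :=
  Complex.sqrt ((Complex.sqrt (k * u) + 2 * (k * u)) /
    (4 * (Real.pi : ℂ) * ∏ l ∈ Finset.Icc 2 (k + 1), c u l))

theorem posAtOne_c_of_mem {l : ℕ} (hl : l ∈ Finset.Icc 2 (k + 1)) : PosAtOne fun u => c u l := by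
  obtain ⟨m, rfl⟩ : ∃ m, l = m + 1 := ⟨l - 1, by have := (Finset.mem_Icc.1 hl).1; omega⟩
  exact posAtOne_c m

theorem posAtOne_four : PosAtOne fun _ => 4 := by
  simpa using PosAtOne.natCast (n := 4) (by norm_num)

theorem posAtOne_singularFactor (hk : 0 < k) : PosAtOne (singularFactor k) :=
  ((posAtOne_four.mul ((posAtOne_sqrt_mul hk).mul (posAtOne_radius hk))).sqrt.div
    posAtOne_two).mul (.prod fun _ hl => (posAtOne_c_of_mem hl).sqrt.inv)

theorem posAtOne_leadingConstant (hk : 0 < k) : PosAtOne (leadingConstant k) :=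
  (((posAtOne_sqrt_mul hk).add (posAtOne_two.mul ((PosAtOne.natCast hk).mul .id))).div
    ((posAtOne_four.mul (.const Real.pi_pos)).mul (.prod fun _ hl => posAtOne_c_of_mem hl))).sqrt

/-- Principal roots are not multiplicative, so the squares are compared, using `1/ρ = 1 + 2√(ku)`;
both sides have positive real part near `u = 1`. -/
theorem eventually_leadingConstant_eq (hk : 0 < k) : ∀ᶠ u in 𝓝 1,
    leadingConstant k u = singularFactor k u / (2 * radius k u * (√Real.pi : ℝ)) := by
  have hpos : PosAtOne fun u => singularFactor k u / (2 * radius k u * (√Real.pi : ℝ)) :=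
    (posAtOne_singularFactor hk).div ((posAtOne_two.mul (posAtOne_radius hk)).mul
      (.const (Real.sqrt_pos.2 Real.pi_pos)))
  have hprod : PosAtOne fun u => ∏ l ∈ Finset.Icc 2 (k + 1), c u l :=
    .prod fun _ hl => posAtOne_c_of_mem hl
  filter_upwards [hpos.eventually_re_pos, (posAtOne_leadingConstant hk).eventually_re_pos,
    eventually_radius_mul hk, (posAtOne_radius hk).eventually_ne_zero,
    hprod.eventually_ne_zero] with u h1 h2 h3 h4 h5
  refine Complex.eq_of_sq_eq_sq_of_re_pos ?_ h2 h1
  have hs := Complex.sqrt_sq (k * u)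
  have hpi : ((√Real.pi : ℝ) : ℂ) ^ 2 = Real.pi := by
    exact_mod_cast Real.sq_sqrt Real.pi_pos.le
  have hpi0 : (Real.pi : ℂ) ≠ 0 := by exact_mod_cast Real.pi_ne_zero
  rw [leadingConstant, singularFactor, Complex.sqrt_sq, div_pow, mul_pow, div_pow, mul_pow, mul_pow,
    Complex.sqrt_sq, ← Finset.prod_pow, hpi]
  simp only [inv_pow, Complex.sqrt_sq, Finset.prod_inv_distrib]
  generalize Complex.sqrt (k * u) = s at *
  rw [← hs]
  generalize ∏ l ∈ Finset.Icc 2 (k + 1), c u l = P at *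
  field_simp
  linear_combination 16 * s * h3

theorem eventually_norm_sub_singularFactor_le (hk : 0 < k) : ∃ K : ℝ, ∀ᶠ u in 𝓝 1, ∀ n : ℕ, 0 < n →
    ‖((n : ℂ) + 1) * (2 * radius k u ^ (n + 1) * openPoly k u 0 n) -
      singularFactor k u * ((√(Real.pi * n))⁻¹ : ℝ)‖ ≤ K * (n : ℝ)⁻¹ := by
  obtain ⟨a, q, ⟨K, hK⟩, ⟨L, hL⟩, haq⟩ := (singularBehaviour hk (zero_add k)).derivative_eq
  obtain ⟨β, hβ, hb⟩ := eventually_norm_conjRatio_le hk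
  refine ⟨K + 20 * L + 4 * L, ?_⟩
  have hpos := (posAtOne_four.mul ((posAtOne_sqrt_mul hk).mul (posAtOne_radius hk))).sqrt
  filter_upwards [hK, hL, haq, hb, eventually_radius_mul hk, hpos.eventually_re_pos] with
    u h1 h2 h3 h4 h5 h6 n hn
  -- Here `1 - b = 4 ρ √(ku)`.
  have hB : evalOne (sqrtSeries (conjRatio k u)) =
      Complex.sqrt (4 * (Complex.sqrt (k * u) * radius k u)) := by
    refine Complex.eq_of_sq_eq_sq_of_re_pos ?_ (re_evalOne_sqrtSeries_pos (h4.trans_lt hβ)) h6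
    rw [evalOne_sqrtSeries_sq (h4.trans hβ.le), Complex.sqrt_sq, conjRatio]
    linear_combination -h5
  have h7 := norm_succ_mul_coeff_sub_le h1 h2 h3.1 hn
  rwa [h3.2, hB, coeff_succ_scaledSeries] at h7

end LambdaTerm

theorem mainTheorem2 (k : ℕ) :
    ∃ δ : ℝ, 0 < δ ∧ ∃ (E : ℕ → ℂ → ℂ) (K : ℝ) (N : ℕ), ∀ n : ℕ, N ≤ n → ∀ u : ℂ, ‖u - 1‖ < δ →
      Polynomial.aeval u (PowerSeries.coeff n (LambdaTerm.genFun k)) =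
          Complex.sqrt ((Complex.sqrt (k * u) + 2 * (k * u)) /
              (4 * (Real.pi : ℂ) * ∏ l ∈ Finset.Icc 2 (k + 1), LambdaTerm.c u l)) *
            (1 + 2 * Complex.sqrt (k * u)) ^ n *
            (((n : ℝ) ^ (-(3 / 2) : ℝ) : ℝ) : ℂ) * (1 + E n u) ∧
        ‖E n u‖ ≤ K / Real.sqrt n := by
  rcases Nat.eq_zero_or_pos k with rfl | hk
  -- For `k = 0` there are no terms, and the leading constant is `√0 = 0`.
  · refine ⟨1, one_pos, fun _ _ => 0, 0, 0, fun n _ u _ => ⟨?_, by simp⟩⟩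
    rw [LambdaTerm.aeval_coeff_genFun, LambdaTerm.openPoly_zero_left]
    simp
  obtain ⟨K, hK⟩ := LambdaTerm.eventually_norm_sub_singularFactor_le hk
  have hfac := LambdaTerm.posAtOne_singularFactor hk
  have hfac0 : 0 < ‖LambdaTerm.singularFactor k 1‖ :=
    norm_pos_iff.2 hfac.eventually_ne_zero.self_of_nhds
  have hμ := hfac.1.norm.eventually (lt_mem_nhds (half_lt_self hfac0))
  set μ := ‖LambdaTerm.singularFactor k 1‖ / 2
  obtain ⟨δ, hδ, h⟩ := Metric.eventually_nhds_iff.1 (hK.and (hμ.and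
    ((LambdaTerm.eventually_leadingConstant_eq hk).and
      ((LambdaTerm.posAtOne_leadingConstant hk).eventually_ne_zero.and
        (LambdaTerm.posAtOne_radius hk).eventually_ne_zero))))
  -- The error is defined as exact quotient minus one, so the formula is an identity once the main
  -- term is nonzero; `n ≥ 1` is needed since `n ^ (-3/2)` is `0` at `n = 0`.
  refine ⟨δ, hδ, fun n u => LambdaTerm.openPoly k u 0 n / (LambdaTerm.leadingConstant k u *
    (LambdaTerm.radius k u)⁻¹ ^ n * (((n : ℝ) ^ (-(3 / 2) : ℝ) : ℝ) : ℂ)) - 1,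
    K * √Real.pi / μ + 1, 1, fun n hn u hu => ?_⟩
  obtain ⟨h1, h2, h3, h4, h5⟩ := h (by rwa [dist_eq_norm] : dist u 1 < δ)
  refine ⟨?_, LambdaTerm.norm_div_sub_one_le hn (half_pos hfac0) h2.le h3 (h1 n hn)⟩
  have hw : (((n : ℝ) ^ (-(3 / 2) : ℝ) : ℝ) : ℂ) ≠ 0 := by
    have : (0 : ℝ) < n := by exact_mod_cast hn
    exact_mod_cast (Real.rpow_pos_of_pos this _).ne'
  have hr : (LambdaTerm.radius k u)⁻¹ = 1 + 2 * Complex.sqrt (k * u) := inv_inv _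
  rw [LambdaTerm.aeval_coeff_genFun, ← hr, add_sub_cancel]
  exact (mul_div_cancel₀ _ (mul_ne_zero (mul_ne_zero h4 (pow_ne_zero n (inv_ne_zero h5))) hw)).symm
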